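/- Let $M$ be a smooth manifold (Hausdorff, second countable, without boundary) and let $h,k\ge 0$ be integers. A pair $(\alpha_1,\alpha_2)$ of smooth $1$-forms on $M$ is a \emph{contact pair of type $(h,k)$} if $\alpha_1\wedge(d\alpha_1)^h\wedge\alpha_2\wedge(d\alpha_2)^k$ is a volume form (so $\dim M=2h+2k+2$), $(d\alpha_1)^{h+1}=0$ and $(d\alpha_2)^{k+1}=0$. Its \emph{Reeb vector fields} are the smooth vector fields $Z_1,Z_2$ determined by $\alpha_i(Z_j)=\delta_{ij}$ and $i_{Z_j}d\alpha_i=0$ for $i,j\in\{1,2\}$. A \emph{metric contact pair} is a $4$-tuple $(\alpha_1,\alpha_2,\phi,g)$ where $(\alpha_1,\alpha_2)$ is a contact pair with Reeb vector fields $Z_1,Z_2$, $\phi$ is a smooth field of endomorphisms of $TM$ with $$\phi^2=-\mathrm{Id}+\alpha_1\otimes Z_1+\alpha_2\otimes Z_2,\qquad \phi(Z_1)=\phi(Z_2)=0,$$ and $g$ is a smooth Riemannian metric that is associated with respect to $(\alpha_1,\alpha_2,\phi)$, i.e. $$g(X,\phi Y)=(d\alpha_1+d\alpha_2)(X,Y),\qquad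 g(X,Z_i)=\alpha_i(X)\quad(i=1,2)$$ for all vector fields $X,Y$. The endomorphism $\phi$ is \emph{decomposable} if $\phi(T\mathcal F_i)\subset T\mathcal F_i$ for $i=1,2$, where $T\mathcal F_i=\ker\alpha_i\cap\ker d\alpha_i$. \textbf{Proposition.} For every contact pair $(\alpha_1,\alpha_2)$ on $M$ (of any type $(h,k)$) there exist a smooth endomorphism field $\phi$ of $TM$ and a smooth Riemannian metric $g$ such that $(\alpha_1,\alpha_2,\phi,g)$ is a metric contact pair. Moreover, $\phi$ (together with $g$) can be chosen so that $\phi$ is decomposable. -/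

import Mathlib

open Bundle ContDiff Manifold

noncomputable section

namespace ContactPair

section LinearAlgebra

variable {V : Type*} [AddCommGroup V] [Module ℝ V]

/-- The wedge product of real alternating forms: the signed sum over shuffles, so that
`(a ∧ b) (v, w) = a v * b w - a w * b v` for `1`-forms. -/
def wedge {m n : ℕ} (a : V [⋀^Fin m]→ₗ[ℝ] ℝ) (b : V [⋀^Fin n]→ₗ[ℝ] ℝ) :
    V [⋀^Fin (m + n)]→ₗ[ℝ] ℝ :=
  ((LinearMap.mul' ℝ ℝ).compAlternatingMap (a.domCoprod b)).domDomCongr finSumFinEquiv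

/-- The wedge power `η ∧ ⋯ ∧ η` (`n` factors) of a `2`-form; the power `0` is the `0`-form `1`. -/
def wedgePow (η : V [⋀^Fin 2]→ₗ[ℝ] ℝ) : (n : ℕ) → V [⋀^Fin (2 * n)]→ₗ[ℝ] ℝ
  | 0 => AlternatingMap.constOfIsEmpty ℝ V (Fin 0) 1
  | n + 1 => wedge (wedgePow η n) η

end LinearAlgebra

variable {E : Type*} [NormedAddCommGroup E] [NormedSpace ℝ E]
  {M : Type*} [TopologicalSpace M] [ChartedSpace E M] [IsManifold 𝓘(ℝ, E) ∞ M]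

variable (E M) in
/-- Smooth `1`-forms on `M`. -/
abbrev OneForm : Type _ :=
  Cₛ^∞⟮𝓘(ℝ, E); E →L[ℝ] ℝ, fun x : M ↦ TangentSpace 𝓘(ℝ, E) x →L[ℝ] ℝ⟯

variable (E M) in
/-- Smooth vector fields on `M`. -/
abbrev VectorField : Type _ :=
  Cₛ^∞⟮𝓘(ℝ, E); E, fun x : M ↦ TangentSpace 𝓘(ℝ, E) x⟯

variable (E M) in
/-- Smooth tensor fields of type `(1,1)` on `M`, i.e. smooth endomorphisms of `TM`. -/
abbrev EndField : Type _ :=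
  Cₛ^∞⟮𝓘(ℝ, E); E →L[ℝ] E,
    fun x : M ↦ TangentSpace 𝓘(ℝ, E) x →L[ℝ] TangentSpace 𝓘(ℝ, E) x⟯

variable (E M) in
/-- Smooth Riemannian metrics on `M`. -/
abbrev Metric : Type _ :=
  ContMDiffRiemannianMetric 𝓘(ℝ, E) ∞ E (fun x : M ↦ TangentSpace 𝓘(ℝ, E) x)

/-- The expression of a `1`-form in the preferred chart at `x`: its pullback under the inverse of
that chart (meaningful on the target of the chart, which is open). -/
def inChart (α : OneForm E M) (x : M) (y : E) : E [⋀^Fin 1]→L[ℝ] ℝ :=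
  ContinuousAlternatingMap.ofSubsingleton ℝ E ℝ (0 : Fin 1)
    ((α ((extChartAt 𝓘(ℝ, E) x).symm y)).comp
      (mfderiv 𝓘(ℝ, E) 𝓘(ℝ, E) (extChartAt 𝓘(ℝ, E) x).symm y))

/-- The exterior derivative `dα` of a `1`-form at `x`: the exterior derivative of its expression in
the preferred chart at `x`, pulled back by the chart. -/
def extDer (α : OneForm E M) (x : M) : TangentSpace 𝓘(ℝ, E) x [⋀^Fin 2]→L[ℝ] ℝ :=
  (extDeriv (inChart α x) (extChartAt 𝓘(ℝ, E) x x)).compContinuousLinearMap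
    (mfderiv 𝓘(ℝ, E) 𝓘(ℝ, E) (extChartAt 𝓘(ℝ, E) x) x)

/-- The value at `x` of a `1`-form, as an alternating form. -/
def formAt (α : OneForm E M) (x : M) : TangentSpace 𝓘(ℝ, E) x [⋀^Fin 1]→ₗ[ℝ] ℝ :=
  AlternatingMap.ofSubsingleton ℝ (TangentSpace 𝓘(ℝ, E) x) ℝ (0 : Fin 1) (α x).toLinearMap

/-- The value at `x` of `(dα)ⁿ`. -/
def extDerPow (α : OneForm E M) (n : ℕ) (x : M) :
    TangentSpace 𝓘(ℝ, E) x [⋀^Fin (2 * n)]→ₗ[ℝ] ℝ :=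
  wedgePow (extDer α x).toAlternatingMap n

/-- `(α₁, α₂)` is a contact pair of type `(h, k)`. The form
`α₁ ∧ (dα₁)ʰ ∧ α₂ ∧ (dα₂)ᵏ` is a volume form: it has top degree and vanishes nowhere. -/
structure IsContactPair (h k : ℕ) (α₁ α₂ : OneForm E M) : Prop where
  top_degree : Module.finrank ℝ E = 2 * h + 2 * k + 2
  volume (x : M) :
    wedge (wedge (wedge (formAt α₁ x) (extDerPow α₁ h x)) (formAt α₂ x)) (extDerPow α₂ k x) ≠ 0
  pow_fst (x : M) : extDerPow α₁ (h + 1) x = 0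
  pow_snd (x : M) : extDerPow α₂ (k + 1) x = 0

/-- `Z₁, Z₂` are the Reeb vector fields of the pair `(α₁, α₂)`. -/
structure IsReebPair (α₁ α₂ : OneForm E M) (Z₁ Z₂ : VectorField E M) : Prop where
  one_one (x : M) : α₁ x (Z₁ x) = 1
  two_two (x : M) : α₂ x (Z₂ x) = 1
  one_two (x : M) : α₁ x (Z₂ x) = 0
  two_one (x : M) : α₂ x (Z₁ x) = 0
  contr_one_one (x : M) (w : TangentSpace 𝓘(ℝ, E) x) : extDer α₁ x ![Z₁ x, w] = 0
  contr_one_two (x : M) (w : TangentSpace 𝓘(ℝ, E) x) : extDer α₂ x ![Z₁ x, w] = 0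
  contr_two_one (x : M) (w : TangentSpace 𝓘(ℝ, E) x) : extDer α₁ x ![Z₂ x, w] = 0
  contr_two_two (x : M) (w : TangentSpace 𝓘(ℝ, E) x) : extDer α₂ x ![Z₂ x, w] = 0

/-- `(α₁, α₂, φ)` is a contact pair structure, where `(α₁, α₂)` has type `(h, k)` and Reeb vector
fields `Z₁, Z₂`. -/
structure IsContactPairStructure (h k : ℕ) (α₁ α₂ : OneForm E M) (Z₁ Z₂ : VectorField E M)
    (φ : EndField E M) : Prop where
  contactPair : IsContactPair h k α₁ α₂
  reeb : IsReebPair α₁ α₂ Z₁ Z₂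
  sq (x : M) (v : TangentSpace 𝓘(ℝ, E) x) :
    φ x (φ x v) = -v + α₁ x v • Z₁ x + α₂ x v • Z₂ x
  map_one (x : M) : φ x (Z₁ x) = 0
  map_two (x : M) : φ x (Z₂ x) = 0

/-- The metric `g` is associated with respect to `(α₁, α₂, φ)`, with Reeb vector fields
`Z₁, Z₂`. -/
structure IsAssociated (α₁ α₂ : OneForm E M) (Z₁ Z₂ : VectorField E M) (φ : EndField E M)
    (g : Metric E M) : Prop where
  inner_map (x : M) (v w : TangentSpace 𝓘(ℝ, E) x) :
    g.inner x v (φ x w) = extDer α₁ x ![v, w] + extDer α₂ x ![v, w]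
  inner_one (x : M) (v : TangentSpace 𝓘(ℝ, E) x) : g.inner x v (Z₁ x) = α₁ x v
  inner_two (x : M) (v : TangentSpace 𝓘(ℝ, E) x) : g.inner x v (Z₂ x) = α₂ x v

/-- `(α₁, α₂, φ, g)` is a metric contact pair, where `(α₁, α₂)` has type `(h, k)`. -/
def IsMetricContactPair (h k : ℕ) (α₁ α₂ : OneForm E M) (φ : EndField E M) (g : Metric E M) :
    Prop :=
  ∃ Z₁ Z₂ : VectorField E M,
    IsContactPairStructure h k α₁ α₂ Z₁ Z₂ φ ∧ IsAssociated α₁ α₂ Z₁ Z₂ φ g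

/-- `v ∈ ker α ∩ ker dα` at `x`, i.e. `v` is tangent to the characteristic foliation of `α`. -/
def TangentToChar (α : OneForm E M) (x : M) (v : TangentSpace 𝓘(ℝ, E) x) : Prop :=
  α x v = 0 ∧ ∀ w : TangentSpace 𝓘(ℝ, E) x, extDer α x ![v, w] = 0

/-- `φ` is decomposable: it preserves the tangent bundles of both characteristic foliations. -/
def IsDecomposable (α₁ α₂ : OneForm E M) (φ : EndField E M) : Prop :=
  ∀ (x : M) (v : TangentSpace 𝓘(ℝ, E) x),
    (TangentToChar α₁ x v → TangentToChar α₁ x (φ x v)) ∧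
    (TangentToChar α₂ x v → TangentToChar α₂ x (φ x v))

end ContactPair

end

/-! Nonvanishing of the volume form means that no nonzero vector is killed by α₁, α₂, dα₁, dα₂
together, and `(dα₁)^(h+1) = 0`, `(dα₂)^(k+1) = 0` bound the ranks of the two 2-forms by 2h and 2k.
A dimension count (`isSplit_of_wedge_ne_zero`) then splits each tangent space into two Reeb lines
and two subspaces, on each of which one dαᵢ is symplectic and the other vanishes.

The form `N = dα₁ + dα₂ + α₁⊗α₁ + α₂⊗α₂` is therefore nondegenerate. The Reeb vectors and the
projections pᵢ to the symplectic summands solve `N Zᵢ = αᵢ` and `N pᵢ = dαᵢ`. From an arbitrary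
scalar product g₀ one builds g₁ making the splitting orthogonal, and applies polar decomposition to
the g₁-skew operator A representing dα₁ + dα₂. A vanishes on the Reeb plane, so the identity of that
plane is added: `Q = -A² + α₁⊗Z₁ + α₂⊗Z₂` is positive definite, `P = √Q`, `φ = P⁻¹A`, and `g(v, w) =
g₁(Pv, w)`. Since P commutes with everything commuting with Q, it commutes with A, which gives the
formula for φ² (`φ_φ`), and with p₁, p₂, which gives decomposability (`p₁_φ`, `b₁_φ`).

Smoothness follows because every tensor solves an invertible linear equation with smooth
coefficients (`contMDiffAt_of_comp_eq`), except P, which is handled by the inverse function theorem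
for squaring (`contMDiffAt_of_isPosSqrt`). The initial g₀ comes from a partition of unity. -/

noncomputable section

namespace ContactPair

/-! ### Smoothness of tensor fields read in the chart at a fixed point. -/

section Coordinates

variable {E : Type*} [NormedAddCommGroup E] [NormedSpace ℝ E]
  {M : Type*} [TopologicalSpace M] [ChartedSpace E M] [IsManifold 𝓘(ℝ, E) ∞ M]

/-- The trivialization of the tangent bundle by the preferred chart at `x₀`, on the fibre over
`x`. -/
def coord (x₀ x : M) : TangentSpace 𝓘(ℝ, E) x →L[ℝ] E :=
  (trivializationAt E (TangentSpace 𝓘(ℝ, E)) x₀).continuousLinearMapAt ℝ x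

/-- The inverse of `coord x₀ x`. -/
def coordSymm (x₀ x : M) : E →L[ℝ] TangentSpace 𝓘(ℝ, E) x :=
  (trivializationAt E (TangentSpace 𝓘(ℝ, E)) x₀).symmL ℝ x

lemma coordSymm_coord {x₀ x : M} (hx : x ∈ (chartAt E x₀).source) (v : TangentSpace 𝓘(ℝ, E) x) :
    coordSymm x₀ x (coord x₀ x v) = v :=
  (trivializationAt E (TangentSpace 𝓘(ℝ, E)) x₀).symmL_continuousLinearMapAt hx v

lemma coord_coordSymm {x₀ x : M} (hx : x ∈ (chartAt E x₀).source) (v : E) :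
    coord x₀ x (coordSymm x₀ x v) = v :=
  (trivializationAt E (TangentSpace 𝓘(ℝ, E)) x₀).continuousLinearMapAt_symmL hx v

/-- A bilinear form on the tangent space at `x`, read in the chart at `x₀`. -/
def coordBilin (x₀ x : M) (b : TangentSpace 𝓘(ℝ, E) x →L[ℝ] TangentSpace 𝓘(ℝ, E) x →L[ℝ] ℝ) :
    E →L[ℝ] E →L[ℝ] ℝ :=
  ((ContinuousLinearMap.precomp ℝ (coordSymm x₀ x)).comp b).comp (coordSymm x₀ x)

@[simp]
lemma coordBilin_apply (x₀ x : M)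
    (b : TangentSpace 𝓘(ℝ, E) x →L[ℝ] TangentSpace 𝓘(ℝ, E) x →L[ℝ] ℝ) (u v : E) :
    coordBilin x₀ x b u v = b (coordSymm x₀ x u) (coordSymm x₀ x v) := rfl

omit [NormedSpace ℝ E] [IsManifold 𝓘(ℝ, E) ∞ M] in
lemma eventually_mem_source (x₀ : M) : ∀ᶠ x in nhds x₀, x ∈ (chartAt E x₀).source :=
  (chartAt E x₀).open_source.mem_nhds (mem_chart_source E x₀)

lemma contMDiffAt_vector_iff (Z : ∀ x : M, TangentSpace 𝓘(ℝ, E) x) (x₀ : M) :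
    ContMDiffAt 𝓘(ℝ, E) (𝓘(ℝ, E).prod 𝓘(ℝ, E)) ∞
        (fun x ↦ TotalSpace.mk' E x (Z x)) x₀ ↔
      ContMDiffAt 𝓘(ℝ, E) 𝓘(ℝ, E) ∞ (fun x ↦ coord x₀ x (Z x)) x₀ := by
  rw [Bundle.contMDiffAt_section]
  refine Filter.EventuallyEq.contMDiffAt_iff ?_
  filter_upwards [eventually_mem_source (E := E) x₀] with x hx
  rw [coord, Trivialization.continuousLinearMapAt_apply, Trivialization.linearMapAt_apply,
    if_pos (show x ∈ (trivializationAt E (TangentSpace 𝓘(ℝ, E)) x₀).baseSet from hx)]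

lemma contMDiffAt_end_iff
    (φ : ∀ x : M, TangentSpace 𝓘(ℝ, E) x →L[ℝ] TangentSpace 𝓘(ℝ, E) x) (x₀ : M) :
    ContMDiffAt 𝓘(ℝ, E) (𝓘(ℝ, E).prod 𝓘(ℝ, E →L[ℝ] E)) ∞
        (fun x ↦ TotalSpace.mk' (E →L[ℝ] E)
          (E := fun x : M ↦ TangentSpace 𝓘(ℝ, E) x →L[ℝ] TangentSpace 𝓘(ℝ, E) x) x (φ x)) x₀ ↔
      ContMDiffAt 𝓘(ℝ, E) 𝓘(ℝ, E →L[ℝ] E) ∞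
        (fun x ↦ ((coord x₀ x).comp (φ x)).comp (coordSymm x₀ x)) x₀ := by
  rw [contMDiffAt_hom_bundle]
  exact and_iff_right contMDiffAt_id

/-- Unlike its companions, this allows a point `x₁` other than the chart's centre: differentiating
the local expression requires its smoothness on the whole chart. -/
lemma contMDiffAt_oneForm_iff
    (α : ∀ x : M, TangentSpace 𝓘(ℝ, E) x →L[ℝ] ℝ) {x₀ x₁ : M} (hx₁ : x₁ ∈ (chartAt E x₀).source) :
    ContMDiffAt 𝓘(ℝ, E) (𝓘(ℝ, E).prod 𝓘(ℝ, E →L[ℝ] ℝ)) ∞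
        (fun x ↦ TotalSpace.mk' (E →L[ℝ] ℝ)
          (E := fun x : M ↦ TangentSpace 𝓘(ℝ, E) x →L[ℝ] ℝ) x (α x)) x₁ ↔
      ContMDiffAt 𝓘(ℝ, E) 𝓘(ℝ, E →L[ℝ] ℝ) ∞
        (fun x ↦ (α x).comp (coordSymm x₀ x)) x₁ := by
  rw [contMDiffAt_section]
  refine (Trivialization.contMDiffWithinAt_snd_comp_iff₂
    (e' := trivializationAt (E →L[ℝ] ℝ) (fun x : M ↦ TangentSpace 𝓘(ℝ, E) x →L[ℝ] ℝ) x₀)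
    (f := fun x ↦ TotalSpace.mk' (E →L[ℝ] ℝ)
      (E := fun x : M ↦ TangentSpace 𝓘(ℝ, E) x →L[ℝ] ℝ) x (α x))
    contMDiffAt_id ?_ ?_).trans (Filter.EventuallyEq.contMDiffAt_iff ?_)
  · simp
  · simpa using hx₁
  filter_upwards with x
  ext v
  simp [hom_trivializationAt_apply, ContinuousLinearMap.inCoordinates, coordSymm]

lemma contMDiffAt_bilin_iff
    (b : ∀ x : M, TangentSpace 𝓘(ℝ, E) x →L[ℝ] TangentSpace 𝓘(ℝ, E) x →L[ℝ] ℝ) (x₀ : M) :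
    ContMDiffAt 𝓘(ℝ, E) (𝓘(ℝ, E).prod 𝓘(ℝ, E →L[ℝ] E →L[ℝ] ℝ)) ∞
        (fun x ↦ TotalSpace.mk' (E →L[ℝ] E →L[ℝ] ℝ)
          (E := fun x : M ↦ TangentSpace 𝓘(ℝ, E) x →L[ℝ] TangentSpace 𝓘(ℝ, E) x →L[ℝ] ℝ)
            x (b x)) x₀ ↔
      ContMDiffAt 𝓘(ℝ, E) 𝓘(ℝ, E →L[ℝ] E →L[ℝ] ℝ) ∞
        (fun x ↦ coordBilin x₀ x (b x)) x₀ := by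
  rw [contMDiffAt_hom_bundle]
  refine (and_iff_right contMDiffAt_id).trans (Filter.EventuallyEq.contMDiffAt_iff ?_)
  filter_upwards [eventually_mem_source (E := E) x₀] with x hx
  ext u v
  rw [inCoordinates_apply_eq₂ hx hx (Set.mem_univ _)]
  simp only [coordBilin_apply, Trivial.fiberBundle_trivializationAt',
    Trivial.linearMapAt_trivialization, LinearMap.id_coe, id_eq, coordSymm]
  rw [Trivialization.symmL_apply _ hx, Trivialization.symmL_apply _ hx]

end Coordinates

/-! ### The exterior derivative of a 1-form as a smooth bilinear form. -/

section ExteriorDerivative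

variable {E : Type*} [NormedAddCommGroup E] [NormedSpace ℝ E]
  {M : Type*} [TopologicalSpace M] [ChartedSpace E M] [IsManifold 𝓘(ℝ, E) ∞ M]

lemma coord_eq_mfderiv {x₀ x : M} (hx : x ∈ (chartAt E x₀).source) :
    coord x₀ x = mfderiv 𝓘(ℝ, E) 𝓘(ℝ, E) (extChartAt 𝓘(ℝ, E) x₀) x :=
  TangentBundle.continuousLinearMapAt_trivializationAt hx

/-- The expression of a `1`-form in the preferred chart at `x₀`. -/
def chartForm (α : OneForm E M) (x₀ : M) (y : E) : E →L[ℝ] ℝ :=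
  (α ((extChartAt 𝓘(ℝ, E) x₀).symm y)).comp (coordSymm x₀ ((extChartAt 𝓘(ℝ, E) x₀).symm y))

lemma coordSymm_eq_mfderiv {x₀ : M} {y : E} (hy : y ∈ (extChartAt 𝓘(ℝ, E) x₀).target) :
    coordSymm (E := E) x₀ ((extChartAt 𝓘(ℝ, E) x₀).symm y) =
      mfderiv 𝓘(ℝ, E) 𝓘(ℝ, E) (extChartAt 𝓘(ℝ, E) x₀).symm y := by
  have hx := (extChartAt 𝓘(ℝ, E) x₀).map_target hy
  rw [extChartAt_source] at hx
  rw [coordSymm, TangentBundle.symmL_trivializationAt hx, (extChartAt 𝓘(ℝ, E) x₀).right_inv hy,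
    ModelWithCorners.range_eq_univ, mfderivWithin_univ]

lemma inChart_eq (α : OneForm E M) {x₀ : M} {y : E} (hy : y ∈ (extChartAt 𝓘(ℝ, E) x₀).target) :
    inChart α x₀ y = ContinuousAlternatingMap.ofSubsingleton ℝ E ℝ (0 : Fin 1)
      (chartForm α x₀ y) := by
  rw [inChart, chartForm, coordSymm_eq_mfderiv hy]

lemma contDiffAt_chartForm (α : OneForm E M) {x₀ : M} {y : E}
    (hy : y ∈ (extChartAt 𝓘(ℝ, E) x₀).target) : ContDiffAt ℝ ∞ (chartForm α x₀) y := by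
  have hx := (extChartAt 𝓘(ℝ, E) x₀).map_target hy
  rw [extChartAt_source] at hx
  rw [← contMDiffAt_iff_contDiffAt]
  have h1 := (contMDiffAt_oneForm_iff (fun x ↦ α x) hx).1 (α.contMDiff _)
  exact h1.comp y ((contMDiffOn_extChartAt_symm x₀).contMDiffAt
    ((isOpen_extChartAt_target x₀).mem_nhds hy))

/-- The exterior derivative of `α`, as a bilinear form in the preferred chart at `x₀`. -/
def chartDer (α : OneForm E M) (x₀ : M) (y : E) : E →L[ℝ] E →L[ℝ] ℝ :=
  fderiv ℝ (chartForm α x₀) y - (fderiv ℝ (chartForm α x₀) y).flip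

set_option synthInstance.maxHeartbeats 200000 in
lemma contDiffAt_chartDer (α : OneForm E M) {x₀ : M} {y : E}
    (hy : y ∈ (extChartAt 𝓘(ℝ, E) x₀).target) : ContDiffAt ℝ ∞ (chartDer α x₀) y := by
  have h : ContDiffAt ℝ ∞ (fderiv ℝ (chartForm α x₀)) y :=
    (contDiffAt_chartForm α hy).fderiv_right (m := ∞) (by simp)
  have hf : ContDiff ℝ ∞ fun b : E →L[ℝ] E →L[ℝ] ℝ ↦ b.flip :=
    (IsLinearMap.with_bound ⟨fun _ _ ↦ rfl, fun _ _ ↦ rfl⟩ 1 fun b ↦ by simp).contDiff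
  exact h.sub (hf.contDiffAt.comp y h)

lemma differentiableAt_inChart (α : OneForm E M) {x₀ : M} {y : E}
    (hy : y ∈ (extChartAt 𝓘(ℝ, E) x₀).target) : DifferentiableAt ℝ (inChart α x₀) y := by
  have h : DifferentiableAt ℝ (fun y ↦ ContinuousAlternatingMap.ofSubsingletonLIE (𝕜 := ℝ) (E := E) (F := ℝ) (0 : Fin 1)
      (chartForm α x₀ y)) y :=
    ((ContinuousAlternatingMap.ofSubsingletonLIE (𝕜 := ℝ) (E := E) (F := ℝ) (0 : Fin 1)).differentiable _).comp y
      ((contDiffAt_chartForm α hy).differentiableAt (by simp))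
  refine h.congr_of_eventuallyEq ?_
  filter_upwards [(isOpen_extChartAt_target x₀).mem_nhds hy] with z hz
  exact inChart_eq α hz

set_option synthInstance.maxHeartbeats 200000 in
lemma extDeriv_inChart (α : OneForm E M) {x₀ : M} {y : E}
    (hy : y ∈ (extChartAt 𝓘(ℝ, E) x₀).target) (v : Fin 2 → E) :
    extDeriv (inChart α x₀) y v = chartDer α x₀ y (v 0) (v 1) := by
  have key (w : Fin 1 → E) (u : E) : fderiv ℝ (fun z ↦ inChart α x₀ z w) y u =
      fderiv ℝ (chartForm α x₀) y u (w 0) := by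
    have : (fun z ↦ inChart α x₀ z w) =ᶠ[nhds y] fun z ↦ chartForm α x₀ z (w 0) := by
      filter_upwards [(isOpen_extChartAt_target x₀).mem_nhds hy] with z hz
      rw [inChart_eq α hz]; rfl
    rw [this.fderiv_eq, fderiv_clm_apply ((contDiffAt_chartForm α hy).differentiableAt (by simp))
      (differentiableAt_const _)]
    simp
  rw [extDeriv_apply (differentiableAt_inChart α hy)]
  simp only [key]
  simp [chartDer, Fin.removeNth, sub_eq_add_neg]

lemma coordSymm_transition {x₀ x₁ : M} {y : E} (hy : y ∈ (extChartAt 𝓘(ℝ, E) x₁).target)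
    (hx : (extChartAt 𝓘(ℝ, E) x₁).symm y ∈ (chartAt E x₀).source) :
    (coordSymm x₀ ((extChartAt 𝓘(ℝ, E) x₁).symm y)).comp
      (fderiv ℝ (extChartAt 𝓘(ℝ, E) x₀ ∘ (extChartAt 𝓘(ℝ, E) x₁).symm) y) =
    coordSymm x₁ ((extChartAt 𝓘(ℝ, E) x₁).symm y) := by
  have h1 : MDifferentiableAt 𝓘(ℝ, E) 𝓘(ℝ, E) (extChartAt 𝓘(ℝ, E) x₁).symm y := by
    have := mdifferentiableWithinAt_extChartAt_symm hy
    rwa [ModelWithCorners.range_eq_univ, mdifferentiableWithinAt_univ] at this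
  have : fderiv ℝ (extChartAt 𝓘(ℝ, E) x₀ ∘ (extChartAt 𝓘(ℝ, E) x₁).symm) y =
      (coord x₀ ((extChartAt 𝓘(ℝ, E) x₁).symm y)).comp
        (coordSymm x₁ ((extChartAt 𝓘(ℝ, E) x₁).symm y)) := by
    rw [← mfderiv_eq_fderiv, coord_eq_mfderiv hx, coordSymm_eq_mfderiv hy]
    exact mfderiv_comp y (mdifferentiableAt_extChartAt hx) h1
  rw [this]
  ext v
  exact coordSymm_coord hx _

/-- `extDer α x` is computed in the chart at `x`, which need not depend continuously on `x`.
Naturality of the exterior derivative under the transition map `τ` moves it to the fixed chart at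
`x₀`, where smoothness in `x` becomes visible. -/
lemma extDer_apply (α : OneForm E M) {x₀ x : M} (hx : x ∈ (chartAt E x₀).source)
    (v : Fin 2 → TangentSpace 𝓘(ℝ, E) x) :
    extDer α x v = chartDer α x₀ (extChartAt 𝓘(ℝ, E) x₀ x) (coord x₀ x (v 0))
      (coord x₀ x (v 1)) := by
  set τ := extChartAt 𝓘(ℝ, E) x₀ ∘ (extChartAt 𝓘(ℝ, E) x).symm with hτ
  set y := extChartAt 𝓘(ℝ, E) x x with hy
  have hyt : y ∈ (extChartAt 𝓘(ℝ, E) x).target := mem_extChartAt_target x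
  have hyx : (extChartAt 𝓘(ℝ, E) x).symm y = x := extChartAt_to_inv x
  have hτy : τ y = extChartAt 𝓘(ℝ, E) x₀ x := by
    rw [hτ, Function.comp_apply, hyx]
  have hs : ContMDiffAt 𝓘(ℝ, E) 𝓘(ℝ, E) ∞ (extChartAt 𝓘(ℝ, E) x).symm y :=
    (contMDiffOn_extChartAt_symm x).contMDiffAt ((isOpen_extChartAt_target x).mem_nhds hyt)
  have hτd : ContDiffAt ℝ ∞ τ y := by
    rw [← contMDiffAt_iff_contDiffAt]
    exact ContMDiffAt.comp y (contMDiffAt_extChartAt' (by rwa [hyx])) hs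
  have hev : inChart α x =ᶠ[nhds y]
      fun z ↦ (inChart α x₀ (τ z)).compContinuousLinearMap (fderiv ℝ τ z) := by
    have h2 : ∀ᶠ z in nhds y, (extChartAt 𝓘(ℝ, E) x).symm z ∈ (chartAt E x₀).source :=
      hs.continuousAt.eventually_mem ((chartAt E x₀).open_source.mem_nhds (by rwa [hyx]))
    filter_upwards [(isOpen_extChartAt_target x).mem_nhds hyt, h2] with z hz hz2
    have hz3 : (extChartAt 𝓘(ℝ, E) x).symm z ∈ (extChartAt 𝓘(ℝ, E) x₀).source := by
      rwa [extChartAt_source]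
    have hz4 : τ z ∈ (extChartAt 𝓘(ℝ, E) x₀).target := (extChartAt 𝓘(ℝ, E) x₀).map_source hz3
    rw [inChart_eq α hz, inChart_eq α hz4]
    ext w
    change chartForm α x z (w 0) = chartForm α x₀ (τ z) (fderiv ℝ τ z (w 0))
    have hp : (extChartAt 𝓘(ℝ, E) x₀).symm (τ z) = (extChartAt 𝓘(ℝ, E) x).symm z :=
      (extChartAt 𝓘(ℝ, E) x₀).left_inv hz3
    rw [chartForm, chartForm, hp, ← coordSymm_transition hz hz2]
    rfl
  have hmap : extChartAt 𝓘(ℝ, E) x₀ x ∈ (extChartAt 𝓘(ℝ, E) x₀).target :=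
    (extChartAt 𝓘(ℝ, E) x₀).map_source (by rwa [extChartAt_source])
  have hτ' : fderiv ℝ τ y = (coord x₀ x).comp (coordSymm x x) := by
    ext v
    have := coordSymm_transition (x₀ := x₀) hyt (by rwa [hyx])
    rw [hyx] at this
    rw [← this]
    exact (coord_coordSymm hx _).symm
  have hext : extDer α x v = extDeriv (inChart α x) y (fun i ↦ coord x x (v i)) := by
    rw [coord_eq_mfderiv (mem_chart_source E x)]; rfl
  rw [hext, hev.extDeriv_eq,
    extDeriv_pullback (r := ∞) (hτy ▸ differentiableAt_inChart α hmap) hτd (by simpa using ENat.LEInfty.out),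
    ContinuousAlternatingMap.compContinuousLinearMap_apply, hτy, extDeriv_inChart α hmap, hτ']
  simp [coordSymm_coord (mem_chart_source E x)]

/-- The exterior derivative `dα` at `x`, as a continuous bilinear form. -/
def extDerBilin (α : OneForm E M) (x : M) :
    TangentSpace 𝓘(ℝ, E) x →L[ℝ] TangentSpace 𝓘(ℝ, E) x →L[ℝ] ℝ :=
  ((ContinuousLinearMap.precomp ℝ (coord x x)).comp
    (chartDer α x (extChartAt 𝓘(ℝ, E) x x))).comp (coord x x)

lemma extDerBilin_apply (α : OneForm E M) (x : M) (v w : TangentSpace 𝓘(ℝ, E) x) :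
    extDerBilin α x v w = extDer α x ![v, w] :=
  (extDer_apply α (mem_chart_source E x) ![v, w]).symm

lemma contMDiff_extDerBilin (α : OneForm E M) :
    ContMDiff 𝓘(ℝ, E) (𝓘(ℝ, E).prod 𝓘(ℝ, E →L[ℝ] E →L[ℝ] ℝ)) ∞
      (fun x ↦ TotalSpace.mk' (E →L[ℝ] E →L[ℝ] ℝ)
        (E := fun x : M ↦ TangentSpace 𝓘(ℝ, E) x →L[ℝ] TangentSpace 𝓘(ℝ, E) x →L[ℝ] ℝ)
          x (extDerBilin α x)) := by
  intro x₀
  rw [contMDiffAt_bilin_iff]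
  have h : ContMDiffAt 𝓘(ℝ, E) 𝓘(ℝ, E →L[ℝ] E →L[ℝ] ℝ) ∞
      (fun x ↦ chartDer α x₀ (extChartAt 𝓘(ℝ, E) x₀ x)) x₀ :=
    (contDiffAt_chartDer α (mem_extChartAt_target x₀)).contMDiffAt.comp x₀ contMDiffAt_extChartAt
  refine h.congr_of_eventuallyEq ?_
  filter_upwards [eventually_mem_source (E := E) x₀] with x hx
  ext u v
  rw [coordBilin_apply, extDerBilin_apply, extDer_apply α hx]
  simp [coord_coordSymm hx]

end ExteriorDerivative

/-! ### Wedge products and contraction. -/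

section Wedge

variable {V : Type*} [AddCommGroup V] [Module ℝ V]

lemma wedge_apply {m n : ℕ} (a : V [⋀^Fin m]→ₗ[ℝ] ℝ) (b : V [⋀^Fin n]→ₗ[ℝ] ℝ)
    (u : Fin (m + n) → V) :
    wedge a b u = ∑ q : Equiv.Perm.ModSumCongr (Fin m) (Fin n),
      LinearMap.mul' ℝ ℝ (AlternatingMap.domCoprod.summand a b q (u ∘ finSumFinEquiv)) := by
  simp only [wedge, AlternatingMap.domDomCongr_apply, LinearMap.compAlternatingMap_apply,
    AlternatingMap.domCoprod_apply, sum_apply, map_sum]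

lemma mul'_summand {m n : ℕ} (a : V [⋀^Fin m]→ₗ[ℝ] ℝ) (b : V [⋀^Fin n]→ₗ[ℝ] ℝ)
    (σ : Equiv.Perm (Fin m ⊕ Fin n)) (w : Fin m ⊕ Fin n → V) :
    LinearMap.mul' ℝ ℝ (AlternatingMap.domCoprod.summand a b (Quotient.mk'' σ) w) =
      ((Equiv.Perm.sign σ : ℤ) : ℝ) * (a (fun i ↦ w (σ (.inl i))) * b fun i ↦ w (σ (.inr i))) := by
  rw [AlternatingMap.domCoprod.summand_mk'', Units.smul_def, smul_apply, map_zsmul,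
    zsmul_eq_mul]
  rfl

/-- Each shuffle hands the argument `v` to one of the two factors, which then vanishes. -/
lemma wedge_eq_zero_of_contraction {m n : ℕ} {a : V [⋀^Fin m]→ₗ[ℝ] ℝ} {b : V [⋀^Fin n]→ₗ[ℝ] ℝ}
    {v : V} (ha : ∀ u : Fin m → V, (∃ i, u i = v) → a u = 0)
    (hb : ∀ u : Fin n → V, (∃ i, u i = v) → b u = 0) (u : Fin (m + n) → V) (hu : ∃ i, u i = v) :
    wedge a b u = 0 := by
  obtain ⟨i, hi⟩ := hu
  rw [wedge_apply]
  refine Finset.sum_eq_zero fun q _ ↦ ?_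
  induction q using Quotient.inductionOn' with | h σ => ?_
  rw [mul'_summand]
  rcases hj : σ⁻¹ (finSumFinEquiv.symm i) with j | j <;> rw [Equiv.Perm.inv_eq_iff_eq] at hj
  · rw [ha _ ⟨j, by simp [← hj, hi]⟩]; simp
  · rw [hb _ ⟨j, by simp [← hj, hi]⟩]; simp

lemma wedgePow_eq_zero_of_contraction {η : V [⋀^Fin 2]→ₗ[ℝ] ℝ} {v : V}
    (hη : ∀ u : Fin 2 → V, (∃ i, u i = v) → η u = 0) (n : ℕ) :
    ∀ u : Fin (2 * n) → V, (∃ i, u i = v) → wedgePow η n u = 0 := by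
  induction n with
  | zero => rintro u ⟨i, -⟩; exact i.elim0
  | succ n ih => exact wedge_eq_zero_of_contraction ih hη

/-- A top degree form that vanishes as soon as one argument is `v ≠ 0` is zero. -/
lemma eq_zero_of_contraction [FiniteDimensional ℝ V] {n : ℕ} (hn : Module.finrank ℝ V = n) {Ω : V [⋀^Fin n]→ₗ[ℝ] ℝ} {v : V}
    (hv : v ≠ 0) (hΩ : ∀ u : Fin n → V, (∃ i, u i = v) → Ω u = 0) : Ω = 0 := by
  ext u
  by_contra hu
  have hli : LinearIndependent ℝ u := by
    by_contra h
    exact hu (Ω.map_linearDependent u h)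
  have : Nonempty (Fin n) := by
    have : Nontrivial V := ⟨v, 0, hv⟩
    exact ⟨⟨0, hn ▸ Module.finrank_pos (R := ℝ) (M := V)⟩⟩
  let b := basisOfLinearIndependentOfCardEqFinrank hli (by simp [hn])
  have hb : ⇑b = u := coe_basisOfLinearIndependentOfCardEqFinrank _ _
  refine hv (b.repr.injective (Finsupp.ext fun i ↦ ?_))
  -- If `Ω u ≠ 0`, then `u` is a basis, and replacing `u i` by `v` multiplies `Ω u` by the `i`-th
  -- coordinate of `v`. Hence all coordinates of `v` vanish.
  have hL : Ω.toMultilinearMap.toLinearMap u i = Ω u • b.coord i := by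
    refine b.ext fun j ↦ ?_
    rw [hb]
    simp only [MultilinearMap.toLinearMap_apply, LinearMap.smul_apply, Module.Basis.coord_apply,
      smul_eq_mul]
    by_cases hij : j = i
    · subst hij; rw [← hb]; simp
    · have h0 : Ω (Function.update u i (u j)) = 0 := Ω.map_update_self u (Ne.symm hij)
      rw [← hb] at h0 ⊢
      simpa [hij] using h0
  have h1 : Ω (Function.update u i v) = Ω u * b.repr v i := congrArg (· v) hL
  rw [hΩ _ ⟨i, by simp⟩] at h1
  simpa using (mul_eq_zero.1 h1.symm).resolve_left hu

end Wedge

/-! ### Darboux families and the rank of a 2-form with vanishing power. -/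

section Darboux

variable {V : Type*} [AddCommGroup V] [Module ℝ V]

/-- Families of vectors paired by `B` as a standard symplectic basis is. -/
structure IsDarboux {m : ℕ} (B : V →ₗ[ℝ] V →ₗ[ℝ] ℝ) (e f : Fin m → V) : Prop where
  left_right (i j : Fin m) : B (e i) (f j) = if i = j then 1 else 0
  left_left (i j : Fin m) : B (e i) (e j) = 0
  right_right (i j : Fin m) : B (f i) (f j) = 0

lemma IsDarboux.comp {m n : ℕ} {B : V →ₗ[ℝ] V →ₗ[ℝ] ℝ} {e f : Fin m → V} (h : IsDarboux B e f)
    {c : Fin n → Fin m} (hc : Function.Injective c) : IsDarboux B (e ∘ c) (f ∘ c) where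
  left_right i j := by simp [h.left_right, hc.eq_iff]
  left_left i j := h.left_left _ _
  right_right i j := h.right_right _ _

/-- A Darboux family of size `m` exists unless the rank of `B` is too small. -/
lemma exists_isDarboux_or_finrank_le [FiniteDimensional ℝ V] {B : V →ₗ[ℝ] V →ₗ[ℝ] ℝ}
    (hB : ∀ v, B v v = 0) (m : ℕ) :
    (∃ e f : Fin m → V, IsDarboux B e f) ∨
      Module.finrank ℝ V + 2 ≤ Module.finrank ℝ (LinearMap.ker B) + 2 * m := by
  have skew (v w : V) : B v w = -B w v := by
    have := hB (v + w)
    simp only [map_add, LinearMap.add_apply, hB] at this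
    linarith
  induction m with
  | zero => exact .inl ⟨Fin.elim0, Fin.elim0, ⟨fun i ↦ i.elim0, fun i ↦ i.elim0, fun i ↦ i.elim0⟩⟩
  | succ m ih =>
  rcases ih with ⟨e, f, h⟩ | h
  swap
  · right; omega
  let Φ : V →ₗ[ℝ] (Fin m ⊕ Fin m → ℝ) := LinearMap.pi (Sum.elim (fun i ↦ B (e i)) fun i ↦ B (f i))
  have hΦ (v : V) : Φ v = 0 ↔ (∀ i, B (e i) v = 0) ∧ ∀ i, B (f i) v = 0 := by
    simp [Φ, funext_iff, Sum.forall]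
  -- `ker Φ` is the `B`-orthogonal complement of the family. Either `B` vanishes on it, so that it
  -- lies in `ker B` and the rank is at most `2 * m`, or it contains a new symplectic pair.
  by_cases hW : ∀ v w, Φ v = 0 → Φ w = 0 → B v w = 0
  · right
    have hle : LinearMap.ker Φ ≤ LinearMap.ker B := by
      intro w hw
      have hw' := (hΦ w).1 hw
      rw [LinearMap.mem_ker]
      ext v
      -- Symplectic Gram–Schmidt: the component of `v` orthogonal to the family.
      set v' := v - ∑ i, B v (f i) • e i + ∑ i, B v (e i) • f i with hv'
      have h1 : Φ v' = 0 := by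
        refine (hΦ v').2 ⟨fun j ↦ ?_, fun j ↦ ?_⟩
        · simp [hv', h.left_right, h.left_left, skew (e j) v]
        · simp [hv', h.right_right, skew (f j) v, skew (f j) (e _), h.left_right]
      have h2 : B v' w = B v w := by simp [hv', hw'.1, hw'.2]
      rw [skew, ← h2, hW _ _ h1 hw]; simp
    have h1 := LinearMap.finrank_range_add_finrank_ker Φ
    have h2 := Submodule.finrank_mono hle
    have h3 := Submodule.finrank_le (LinearMap.range Φ)
    simp only [Module.finrank_fintype_fun_eq_card, Fintype.card_sum, Fintype.card_fin] at h3
    omega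
  · left
    push Not at hW
    obtain ⟨v, w, hv, hw, hvw⟩ := hW
    rw [hΦ] at hv hw
    refine ⟨Fin.snoc e ((B v w)⁻¹ • v), Fin.snoc f w, ⟨fun i j ↦ ?_, fun i j ↦ ?_, fun i j ↦ ?_⟩⟩
    · induction i using Fin.lastCases with
      | last => induction j using Fin.lastCases with
        | last => simp [hvw]
        | cast j => simp [skew v, hv.2, (Fin.castSucc_lt_last j).ne']
      | cast i => induction j using Fin.lastCases with
        | last => simp [hw.1, (Fin.castSucc_lt_last i).ne]
        | cast j => simp [h.left_right]
    · induction i using Fin.lastCases with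
      | last => induction j using Fin.lastCases with
        | last => simp [hB]
        | cast j => simp [skew v, hv.1]
      | cast i => induction j using Fin.lastCases with
        | last => simp [hv.1]
        | cast j => simp [h.left_left]
    · induction i using Fin.lastCases with
      | last => induction j using Fin.lastCases with
        | last => simp [hB]
        | cast j => simp [skew w, hw.2]
      | cast i => induction j using Fin.lastCases with
        | last => simp [hw.2]
        | cast j => simp [h.right_right]

/-- The pair `(j, b)` as the index `2 j + b`. -/
def pairIndex (m : ℕ) : Fin m × Fin 2 ≃ Fin (2 * m) :=
  finProdFinEquiv.trans (finCongr (mul_comm m 2))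

lemma pairIndex_val (m : ℕ) (p : Fin m × Fin 2) : (pairIndex m p : ℕ) = p.2 + 2 * p.1 := rfl

/-- `pairIndex (n + 1)`, with the last pair split off. -/
def pairIndexSum (n : ℕ) : Fin (n + 1) × Fin 2 ≃ Fin (2 * n) ⊕ Fin 2 :=
  (pairIndex (n + 1)).trans finSumFinEquiv.symm

lemma pairIndexSum_castSucc (n : ℕ) (j : Fin n) (b : Fin 2) :
    pairIndexSum n (j.castSucc, b) = .inl (pairIndex n (j, b)) := by
  rw [pairIndexSum, Equiv.trans_apply, Equiv.symm_apply_eq]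
  ext; simp [pairIndex_val]; rfl

lemma pairIndexSum_last (n : ℕ) (b : Fin 2) : pairIndexSum n (Fin.last n, b) = .inr b := by
  rw [pairIndexSum, Equiv.trans_apply, Equiv.symm_apply_eq]
  ext; simp [pairIndex_val]; exact add_comm _ _

/-- The vectors of two families as one family indexed by pairs. -/
def pairFamily {m : ℕ} (e f : Fin m → V) (p : Fin m × Fin 2) : V := if p.2 = 0 then e p.1 else f p.1

/-- In the shuffle sum a term is nonzero only if the last factor receives some pair `e j, f j`. All
such terms are positive: moving whole pairs is an even permutation, and the other factor sees a
Darboux family of size `n`. So nothing cancels, and the exact value is not needed. -/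
lemma wedgePow_pos {η : V [⋀^Fin 2]→ₗ[ℝ] ℝ} {B : V →ₗ[ℝ] V →ₗ[ℝ] ℝ}
    (hη : ∀ v w, η ![v, w] = B v w) (n : ℕ) (e f : Fin n → V) (h : IsDarboux B e f) :
    0 < wedgePow η n (pairFamily e f ∘ (pairIndex n).symm) := by
  have hB (v w : V) : B v w = -B w v := by
    have hs := η.map_swap ![w, v] (i := 0) (j := 1) (by decide)
    rw [← hη, ← hη, ← hs]
    congr 1
    ext i; fin_cases i <;> rfl
  induction n with
  | zero => simp [wedgePow]
  | succ n ih =>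
  set κ := pairIndexSum n
  set w : Fin (2 * n) ⊕ Fin 2 → V := pairFamily e f ∘ κ.symm with hw
  have hwu : (pairFamily e f ∘ (pairIndex (n + 1)).symm) ∘ finSumFinEquiv = w := rfl
  change 0 < wedge (wedgePow η n) η _
  rw [wedge_apply, hwu]
  have hη' (σ : Equiv.Perm (Fin (2 * n) ⊕ Fin 2)) :
      η (fun i ↦ w (σ (.inr i))) = B (w (σ (.inr 0))) (w (σ (.inr 1))) := by
    rw [← hη]; congr 1; ext i; fin_cases i <;> rfl
  have main (σ : Equiv.Perm (Fin (2 * n) ⊕ Fin 2)) (j : Fin (n + 1))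
      (hσ : ∀ b, σ (.inr b) = κ (j, b)) :
      0 < LinearMap.mul' ℝ ℝ (AlternatingMap.domCoprod.summand (wedgePow η n) η
        (Quotient.mk'' σ) w) := by
    -- `τ` exchanges the `j`-th pair with the last one. It acts by the same swap on both members of
    -- the pairs, hence is even.
    set τ : Equiv.Perm (Fin (2 * n) ⊕ Fin 2) :=
      κ.permCongr (Equiv.prodCongrLeft fun _ ↦ Equiv.swap j (Fin.last n)) with hτ
    have hτκ (k b) : τ (κ (k, b)) = κ (Equiv.swap j (Fin.last n) k, b) := by
      simp [hτ, Equiv.permCongr_apply]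
    have hτ2 (x) : τ (τ x) = x := by
      obtain ⟨⟨k, b⟩, rfl⟩ := κ.surjective x
      rw [hτκ, hτκ, Equiv.swap_apply_self]
    have hτs : Equiv.Perm.sign τ = 1 := by
      rw [hτ, Equiv.Perm.sign_permCongr, Equiv.Perm.sign_prodCongrLeft]
      simp
    -- `τ * σ` fixes the last block pointwise, so it is a permutation `s` of the first block. The
    -- sign of `s` occurs once from the shuffle and once from reordering the arguments.
    have hρ : τ * σ ∈ (Equiv.Perm.sumCongrHom (Fin (2 * n)) (Fin 2)).range := by
      refine Equiv.Perm.mem_sumCongrHom_range_of_perm_mapsTo_inl ?_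
      rw [Equiv.Perm.perm_mapsTo_inl_iff_mapsTo_inr]
      rintro _ ⟨b, rfl⟩
      refine ⟨b, ?_⟩
      rw [Equiv.Perm.mul_apply, hσ, hτκ, Equiv.swap_apply_left, pairIndexSum_last]
    obtain ⟨⟨s, t⟩, hst⟩ := hρ
    have ht : t = 1 := by
      ext1 b
      have h1 : (τ * σ) (.inr b) = .inr (t b) := by rw [← hst]; simp
      rw [Equiv.Perm.mul_apply, hσ, hτκ, Equiv.swap_apply_left, pairIndexSum_last] at h1
      simpa using h1.symm
    have hs (i) : σ (.inl i) = τ (.inl (s i)) := by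
      have h1 : (τ * σ) (.inl i) = .inl (s i) := by rw [← hst]; simp
      rw [← h1, Equiv.Perm.mul_apply, hτ2]
    have hsign : Equiv.Perm.sign σ = Equiv.Perm.sign s := by
      have := congrArg Equiv.Perm.sign hst
      simpa [hτs, ht] using this.symm
    have hfam : (fun i ↦ w (σ (.inl i))) =
        (pairFamily (e ∘ Equiv.swap j (Fin.last n) ∘ Fin.castSucc)
          (f ∘ Equiv.swap j (Fin.last n) ∘ Fin.castSucc) ∘ (pairIndex n).symm) ∘ s := by
      ext i
      obtain ⟨⟨k, b⟩, hk⟩ := (pairIndex n).surjective (s i)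
      simp only [hs, Function.comp_apply, ← hk, ← pairIndexSum_castSucc]
      change w (τ (κ _)) = _
      rw [hτκ, hw]
      simp [pairFamily]
    rw [mul'_summand, hη', hσ, hσ, hfam, AlternatingMap.map_perm, hsign]
    have hpos := ih _ _ (h.comp (c := Equiv.swap j (Fin.last n) ∘ Fin.castSucc)
      ((Equiv.injective _).comp (Fin.castSucc_injective n)))
    have h1 : B (w (κ (j, 0))) (w (κ (j, 1))) = 1 := by simp [hw, pairFamily, h.left_right]
    rw [h1, mul_one, Units.smul_def, zsmul_eq_mul, ← mul_assoc, ← Int.cast_mul, ← Units.val_mul,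
      Int.units_mul_self]
    simpa using hpos
  refine Finset.sum_pos' (fun q _ ↦ ?_) ⟨Quotient.mk'' 1, Finset.mem_univ _, ?_⟩
  · induction q using Quotient.inductionOn' with | h σ => ?_
    by_cases h0 : B (w (σ (.inr 0))) (w (σ (.inr 1))) = 0
    · rw [mul'_summand, hη', h0]; simp
    obtain ⟨⟨j, b⟩, hj⟩ := κ.surjective (σ (.inr 0))
    obtain ⟨⟨j', b'⟩, hj'⟩ := κ.surjective (σ (.inr 1))
    have h1 : B (pairFamily e f (j, b)) (pairFamily e f (j', b')) ≠ 0 := by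
      simpa [hw, ← hj, ← hj'] using h0
    fin_cases b <;> fin_cases b' <;>
      simp only [pairFamily, h.left_left, h.right_right, h.left_right, Fin.zero_eta, Fin.mk_one,
        Fin.isValue, ↓reduceIte, one_ne_zero, ne_eq, not_true_eq_false] at h1
    · obtain rfl : j = j' := by by_contra hne; simp [hne] at h1
      refine (main σ j fun b ↦ ?_).le
      fin_cases b
      exacts [hj.symm, hj'.symm]
    · obtain rfl : j = j' := by
        by_contra hne
        have := hB (f j) (e j')
        simp [h.left_right, Ne.symm hne] at this
        simp [this] at h1
      -- The pair arrives in the order `f j, e j`; another representative of the same coset reverses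
      -- it.
      have hq : (Quotient.mk'' σ : Equiv.Perm.ModSumCongr (Fin (2 * n)) (Fin 2)) =
          Quotient.mk'' (σ * Equiv.Perm.sumCongrHom _ _ (1, Equiv.swap 0 1)) := by
        refine Quotient.sound' ?_
        rw [QuotientGroup.leftRel_apply]
        exact ⟨(1, Equiv.swap 0 1), by simp⟩
      rw [hq]
      refine (main _ j fun b ↦ ?_).le
      fin_cases b
      · simpa using hj'.symm
      · simpa using hj.symm
  · exact main 1 (Fin.last n) fun b ↦ (pairIndexSum_last n b).symm

/-- A rank above `2 * n` would yield a Darboux family of size `n + 1`, on which the power is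
positive. -/
lemma finrank_le_finrank_ker_of_wedgePow_eq_zero [FiniteDimensional ℝ V]
    {η : V [⋀^Fin 2]→ₗ[ℝ] ℝ} {B : V →ₗ[ℝ] V →ₗ[ℝ] ℝ} (hη : ∀ v w, η ![v, w] = B v w) {n : ℕ}
    (h : wedgePow η (n + 1) = 0) :
    Module.finrank ℝ V ≤ Module.finrank ℝ (LinearMap.ker B) + 2 * n := by
  have hB (v : V) : B v v = 0 := by
    rw [← hη]
    exact η.map_eq_zero_of_eq _ (i := 0) (j := 1) rfl (by decide)
  rcases exists_isDarboux_or_finrank_le hB (n + 1) with ⟨e, f, hef⟩ | h'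
  · have := wedgePow_pos hη (n + 1) e f hef
    simp [h] at this
  · omega

end Darboux

/-! ### The splitting of a tangent space. -/

section Pointwise

variable {V : Type*} [AddCommGroup V] [Module ℝ V]

/-- The characteristic subspace `ker a ∩ ker B` of a `1`-form `a` with derivative `B`. -/
def charSubspace (a : V →ₗ[ℝ] ℝ) (B : V →ₗ[ℝ] V →ₗ[ℝ] ℝ) : Submodule ℝ V :=
  LinearMap.ker a ⊓ LinearMap.ker B

lemma finrank_ker_le_finrank_charSubspace [FiniteDimensional ℝ V] (a : V →ₗ[ℝ] ℝ)
    (B : V →ₗ[ℝ] V →ₗ[ℝ] ℝ) :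
    Module.finrank ℝ (LinearMap.ker B) ≤ Module.finrank ℝ (charSubspace a B) + 1 := by
  have h1 := Submodule.finrank_sup_add_finrank_inf_eq (LinearMap.ker a) (LinearMap.ker B)
  have h2 := Submodule.finrank_le (LinearMap.ker a ⊔ LinearMap.ker B)
  have h3 := LinearMap.finrank_range_add_finrank_ker a
  have h4 := Submodule.finrank_le (LinearMap.range a)
  rw [Module.finrank_self] at h4
  unfold charSubspace
  omega

/-- A vector dual to `a₁` in the kernel of `B₁` and in the characteristic subspace of the other
form. -/
lemma exists_reeb [FiniteDimensional ℝ V] {a₁ a₂ : V →ₗ[ℝ] ℝ} {B₁ B₂ : V →ₗ[ℝ] V →ₗ[ℝ] ℝ}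
    (hdisj : charSubspace a₁ B₁ ⊓ charSubspace a₂ B₂ = ⊥)
    (hdim : Module.finrank ℝ V <
      Module.finrank ℝ (LinearMap.ker B₁) + Module.finrank ℝ (charSubspace a₂ B₂)) :
    ∃ z, a₁ z = 1 ∧ a₂ z = 0 ∧ B₁ z = 0 ∧ B₂ z = 0 := by
  have h1 := Submodule.finrank_sup_add_finrank_inf_eq (LinearMap.ker B₁) (charSubspace a₂ B₂)
  have h2 := Submodule.finrank_le (LinearMap.ker B₁ ⊔ charSubspace a₂ B₂)
  -- By dimension there is a nonzero vector here. If `a₁` killed it, it would lie in both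
  -- characteristic subspaces; otherwise it can be normalized.
  have h3 : LinearMap.ker B₁ ⊓ charSubspace a₂ B₂ ≠ ⊥ := by
    intro h
    rw [h, finrank_bot] at h1
    omega
  obtain ⟨v, hv, hv0⟩ := Submodule.exists_mem_ne_zero_of_ne_bot h3
  have hv1 : B₁ v = 0 := hv.1
  have hv2 : a₂ v = 0 := hv.2.1
  have hv3 : B₂ v = 0 := hv.2.2
  have ha : a₁ v ≠ 0 := fun h ↦ hv0 <| by
    have : v ∈ charSubspace a₁ B₁ ⊓ charSubspace a₂ B₂ := ⟨⟨h, hv1⟩, hv.2⟩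
    rwa [hdisj, Submodule.mem_bot] at this
  exact ⟨(a₁ v)⁻¹ • v, by simp [ha], by simp [hv2], by simp [hv1], by simp [hv3]⟩

/-- The linear algebra of a contact pair: `V` is the direct sum of two lines spanned by dual Reeb
vectors and of two subspaces, on each of which one of the `2`-forms is symplectic and the other
vanishes. -/
structure IsSplit (a₁ a₂ : V →ₗ[ℝ] ℝ) (B₁ B₂ : V →ₗ[ℝ] V →ₗ[ℝ] ℝ) : Prop where
  skew_fst (v w : V) : B₁ v w = -B₁ w v
  skew_snd (v w : V) : B₂ v w = -B₂ w v
  reeb_fst : ∃ z, a₁ z = 1 ∧ a₂ z = 0 ∧ B₁ z = 0 ∧ B₂ z = 0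
  reeb_snd : ∃ z, a₁ z = 0 ∧ a₂ z = 1 ∧ B₁ z = 0 ∧ B₂ z = 0
  eq_zero (v : V) : a₁ v = 0 → a₂ v = 0 → B₁ v = 0 → B₂ v = 0 → v = 0
  proj (v : V) : ∃ u, a₁ u = 0 ∧ a₂ u = 0 ∧ B₁ u = B₁ v ∧ B₂ u = 0

lemma skew_of_alternating {η : V [⋀^Fin 2]→ₗ[ℝ] ℝ} {B : V →ₗ[ℝ] V →ₗ[ℝ] ℝ}
    (hη : ∀ v w, η ![v, w] = B v w) (v w : V) : B v w = -B w v := by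
  have hs := η.map_swap ![w, v] (i := 0) (j := 1) (by decide)
  rw [← hη, ← hη, ← hs]
  congr 1
  ext i; fin_cases i <;> rfl

lemma alternating_eq_zero {η : V [⋀^Fin 2]→ₗ[ℝ] ℝ} {B : V →ₗ[ℝ] V →ₗ[ℝ] ℝ}
    (hη : ∀ v w, η ![v, w] = B v w) {v : V} (hv : B v = 0) (u : Fin 2 → V) (hu : ∃ i, u i = v) :
    η u = 0 := by
  have h : η u = B (u 0) (u 1) := by
    rw [← hη]; congr 1; ext i; fin_cases i <;> rfl
  obtain ⟨i, rfl⟩ := hu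
  rw [h]
  fin_cases i
  · exact congrArg (· (u 1)) hv
  · rw [skew_of_alternating hη]
    exact neg_eq_zero.2 (congrArg (· (u 0)) hv)

/-- The rank bounds give dimension at least `2k + 2` for `ker B₁` and `2h + 2` for `ker B₂`, hence
at least `2k + 1` and `2h + 1` for the characteristic subspaces. These meet trivially because of the
volume form, so by dimension they span `V`. -/
lemma isSplit_of_wedge_ne_zero [FiniteDimensional ℝ V] {h k : ℕ} {a₁ a₂ : V →ₗ[ℝ] ℝ}
    {B₁ B₂ : V →ₗ[ℝ] V →ₗ[ℝ] ℝ} {η₁ η₂ : V [⋀^Fin 2]→ₗ[ℝ] ℝ}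
    (hη₁ : ∀ v w, η₁ ![v, w] = B₁ v w) (hη₂ : ∀ v w, η₂ ![v, w] = B₂ v w)
    (hdim : Module.finrank ℝ V = 2 * h + 2 * k + 2)
    (hvol : wedge (wedge (wedge (AlternatingMap.ofSubsingleton ℝ V ℝ (0 : Fin 1) a₁)
      (wedgePow η₁ h)) (AlternatingMap.ofSubsingleton ℝ V ℝ (0 : Fin 1) a₂)) (wedgePow η₂ k) ≠ 0)
    (h₁ : wedgePow η₁ (h + 1) = 0) (h₂ : wedgePow η₂ (k + 1) = 0) : IsSplit a₁ a₂ B₁ B₂ := by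
  have hone (a : V →ₗ[ℝ] ℝ) {v : V} (hv : a v = 0) (u : Fin 1 → V) (hu : ∃ i, u i = v) :
      AlternatingMap.ofSubsingleton ℝ V ℝ (0 : Fin 1) a u = 0 := by
    obtain ⟨i, rfl⟩ := hu
    rw [Subsingleton.elim i 0] at hv
    exact hv
  have hzero (v : V) (ha₁ : a₁ v = 0) (ha₂ : a₂ v = 0) (hB₁ : B₁ v = 0) (hB₂ : B₂ v = 0) :
      v = 0 := by
    by_contra hv
    refine hvol (eq_zero_of_contraction (by omega) hv ?_)
    exact wedge_eq_zero_of_contraction (wedge_eq_zero_of_contraction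
      (wedge_eq_zero_of_contraction (hone a₁ ha₁)
        (wedgePow_eq_zero_of_contraction (alternating_eq_zero hη₁ hB₁) h)) (hone a₂ ha₂))
      (wedgePow_eq_zero_of_contraction (alternating_eq_zero hη₂ hB₂) k)
  have hdisj : charSubspace a₁ B₁ ⊓ charSubspace a₂ B₂ = ⊥ :=
    (Submodule.eq_bot_iff _).2 fun v hv ↦ hzero v hv.1.1 hv.2.1 hv.1.2 hv.2.2
  have hk₁ := finrank_le_finrank_ker_of_wedgePow_eq_zero hη₁ h₁
  have hk₂ := finrank_le_finrank_ker_of_wedgePow_eq_zero hη₂ h₂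
  have hc₁ := finrank_ker_le_finrank_charSubspace a₁ B₁
  have hc₂ := finrank_ker_le_finrank_charSubspace a₂ B₂
  have hsup : charSubspace a₁ B₁ ⊔ charSubspace a₂ B₂ = ⊤ := by
    have h1 := Submodule.finrank_sup_add_finrank_inf_eq (charSubspace a₁ B₁) (charSubspace a₂ B₂)
    rw [hdisj, finrank_bot] at h1
    refine Submodule.eq_top_of_finrank_eq (le_antisymm (Submodule.finrank_le _) ?_)
    omega
  have hz₁ := exists_reeb hdisj (by omega)
  have hz₂ := exists_reeb (a₁ := a₂) (a₂ := a₁) (B₁ := B₂) (B₂ := B₁)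
    (by rw [inf_comm]; exact hdisj) (by omega)
  refine ⟨skew_of_alternating hη₁, skew_of_alternating hη₂, hz₁, ?_, hzero, fun v ↦ ?_⟩
  · obtain ⟨z, h1, h2, h3, h4⟩ := hz₂
    exact ⟨z, h2, h1, h4, h3⟩
  · obtain ⟨z, hz1, hz2, hz3, hz4⟩ := hz₁
    obtain ⟨p, hp, q, hq, rfl⟩ := Submodule.mem_sup.1 (hsup ▸ Submodule.mem_top : v ∈ _)
    have hp2 : B₁ p = 0 := hp.2
    have hq1 : a₂ q = 0 := hq.1
    have hq2 : B₂ q = 0 := hq.2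
    -- The summand `p` is invisible to `B₁` and `q` to `B₂`; subtracting the Reeb part of `q` makes
    -- `a₁` vanish.
    exact ⟨q - a₁ q • z, by simp [hz1], by simp [hq1, hz2], by simp [hp2, hz3],
      by simp [hq2, hz4]⟩

end Pointwise

/-! ### Positive square roots. -/

section SquareRoot

variable {V : Type*} [AddCommGroup V] [Module ℝ V]

/-- `P` is the positive square root of `Q` with respect to the scalar product `G`. -/
structure IsPosSqrt (G : V →ₗ[ℝ] V →ₗ[ℝ] ℝ) (Q P : V →ₗ[ℝ] V) : Prop where
  sq : P ∘ₗ P = Q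
  symm (v w : V) : G (P v) w = G v (P w)
  pos (v : V) : v ≠ 0 → 0 < G (P v) v
  comm (T : V →ₗ[ℝ] V) : T ∘ₗ Q = Q ∘ₗ T → T ∘ₗ P = P ∘ₗ T

/-- As `R` commutes with `Q`, it commutes with `P`, so `(R + P)(R - P) = 0` while `R + P` is
positive. Symmetry of `R` is not needed, which matters for roots produced by the inverse function
theorem. -/
lemma IsPosSqrt.unique {G : V →ₗ[ℝ] V →ₗ[ℝ] ℝ} {Q P R : V →ₗ[ℝ] V} (h : IsPosSqrt G Q P)
    (hR : R ∘ₗ R = Q) (hpos : ∀ v ≠ 0, 0 < G (R v) v) : R = P := by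
  have hc : R ∘ₗ P = P ∘ₗ R := h.comm R (by rw [← hR]; rfl)
  ext v
  by_contra hne
  have h1 : R (R v - P v) + P (R v - P v) = 0 := by
    have e1 : R (R v) = P (P v) := by
      simpa using (LinearMap.congr_fun hR v).trans (LinearMap.congr_fun h.sq v).symm
    have e2 : R (P v) = P (R v) := LinearMap.congr_fun hc v
    rw [map_sub, map_sub, e1, e2]; abel
  have h2 := hpos _ (sub_ne_zero.2 hne)
  have h3 := h.pos _ (sub_ne_zero.2 hne)
  have h4 : G (R (R v - P v)) (R v - P v) + G (P (R v - P v)) (R v - P v) = 0 := by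
    rw [← LinearMap.add_apply, ← map_add, h1]; simp
  linarith

lemma exists_isPosSqrt [FiniteDimensional ℝ V] {G : V →ₗ[ℝ] V →ₗ[ℝ] ℝ}
    (hsymm : ∀ v w, G v w = G w v) (hpos : ∀ v ≠ 0, 0 < G v v) {Q : V →ₗ[ℝ] V}
    (hQ : ∀ v w, G (Q v) w = G v (Q w)) (hQpos : ∀ v ≠ 0, 0 < G (Q v) v) :
    ∃ P, IsPosSqrt G Q P := by
  have hnonneg (v : V) : 0 ≤ G v v := by
    rcases eq_or_ne v 0 with rfl | hv
    · simp
    · exact (hpos v hv).le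
  let core : InnerProductSpace.Core ℝ V :=
    { inner := fun v w ↦ G v w
      conj_inner_symm := fun v w ↦ by simpa using hsymm w v
      re_inner_nonneg := fun v ↦ by simpa using hnonneg v
      add_left := fun u v w ↦ by simp
      smul_left := fun u v r ↦ by simp
      definite := fun v hv ↦ by
        by_contra hne
        exact (hpos v hne).ne' hv }
  let _ : NormedAddCommGroup V := core.toNormedAddCommGroup
  let _ : InnerProductSpace ℝ V := .ofCore core.toCore
  have hQs : Q.IsSymmetric := hQ
  set b := hQs.eigenvectorBasis rfl with hb
  set l := hQs.eigenvalues rfl with hl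
  have hQb (i) : Q (b i) = l i • b i := hQs.apply_eigenvectorBasis rfl i
  have horth (i j) : G (b i) (b j) = if i = j then 1 else 0 :=
    orthonormal_iff_ite.1 b.orthonormal i j
  have hzero (v : V) (hv : ∀ i, G (b i) v = 0) : v = 0 := by
    refine b.repr.injective ?_
    ext i
    rw [b.repr_apply_apply]
    simpa using! hv i
  have hlpos (i) : 0 < l i := by
    have h1 := hQpos (b i) (b.orthonormal.ne_zero i)
    simpa [hQb, horth] using h1
  let P : V →ₗ[ℝ] V := ∑ i, √(l i) • (G (b i)).smulRight (b i)
  have hP (v : V) : P v = ∑ i, (√(l i) * G (b i) v) • b i := by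
    simp [P, LinearMap.sum_apply, smul_smul]
  have hGP (v w : V) : G (P v) w = ∑ i, √(l i) * G (b i) v * G (b i) w := by
    simp [hP, LinearMap.sum_apply]
  have hPsymm (v w : V) : G (P v) w = G v (P w) := by
    rw [hsymm v, hGP, hGP]
    exact Finset.sum_congr rfl fun i _ ↦ by ring
  -- This holds for all eigenvectors of `Q`, not only the basis. An operator commuting with `Q`
  -- sends `b i` to such a vector (or to zero), hence commutes with `P`.
  have heig (v : V) (μ : ℝ) (hv : Q v = μ • v) : P v = √μ • v := by
    refine sub_eq_zero.1 (hzero _ fun i ↦ ?_)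
    have h1 : G (b i) (P v) = √(l i) * G (b i) v := by
      rw [hsymm, hGP, Finset.sum_eq_single i (fun j _ hj ↦ by simp [horth, hj]) (by simp)]
      simp [horth]
    have h2 : l i * G (b i) v = μ * G (b i) v := by
      have := hQ (b i) v
      simpa [hQb, hv] using this
    rw [map_sub, h1, map_smul, smul_eq_mul]
    rcases eq_or_ne (G (b i) v) 0 with h0 | h0
    · simp [h0]
    · rw [mul_right_cancel₀ h0 h2, sub_self]
  have hPb (i) : P (b i) = √(l i) • b i := heig _ _ (hQb i)
  refine ⟨P, ?_, hPsymm, fun v hv ↦ ?_, fun T hT ↦ ?_⟩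
  · refine b.toBasis.ext fun i ↦ ?_
    simp [hPb, hQb, smul_smul, Real.mul_self_sqrt (hlpos i).le]
  · obtain ⟨i, hi⟩ : ∃ i, G (b i) v ≠ 0 := by
      by_contra! h
      exact hv (hzero v h)
    rw [hGP]
    refine Finset.sum_pos' (fun j _ ↦ ?_) ⟨i, Finset.mem_univ _, ?_⟩
    · rw [mul_assoc]
      exact mul_nonneg (Real.sqrt_nonneg _) (mul_self_nonneg _)
    · rw [mul_assoc]
      exact mul_pos (Real.sqrt_pos.2 (hlpos i)) (mul_self_pos.2 hi)
  · refine b.toBasis.ext fun i ↦ ?_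
    have h1 : Q (T (b i)) = l i • T (b i) := by
      have := LinearMap.congr_fun hT (b i)
      simpa [hQb] using this.symm
    simp [hPb, heig _ _ h1]

end SquareRoot

/-- A continuous bilinear form, as a bilinear map. -/
def toBilin {V : Type*} [AddCommGroup V] [Module ℝ V] [TopologicalSpace V]
    (b : V →L[ℝ] V →L[ℝ] ℝ) : V →ₗ[ℝ] V →ₗ[ℝ] ℝ :=
  (ContinuousLinearMap.coeLM ℝ).comp b.toLinearMap

@[simp]
lemma toBilin_apply {V : Type*} [AddCommGroup V] [Module ℝ V] [TopologicalSpace V]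
    (b : V →L[ℝ] V →L[ℝ] ℝ) (v w : V) : toBilin b v w = b v w := rfl

/-! ### Smooth dependence of linear solutions and square roots. -/

section Smooth

variable {E : Type*} [NormedAddCommGroup E] [NormedSpace ℝ E]
  {F : Type*} [NormedAddCommGroup F] [NormedSpace ℝ F] [FiniteDimensional ℝ F]
  {M : Type*} [TopologicalSpace M] [ChartedSpace E M]

/-- Positivity need only be tested on the compact unit sphere, where it is an open condition. -/
lemma eventually_pos_of_pos {b₀ : F →L[ℝ] F →L[ℝ] ℝ} (h : ∀ v ≠ 0, 0 < b₀ v v) :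
    ∀ᶠ b : F →L[ℝ] F →L[ℝ] ℝ in nhds b₀, ∀ v ≠ 0, 0 < b v v := by
  have hK : ∀ᶠ b : F →L[ℝ] F →L[ℝ] ℝ in nhds b₀, ∀ v ∈ Metric.sphere (0 : F) 1, 0 < b v v := by
    refine (isCompact_sphere (0 : F) 1).eventually_forall_of_forall_eventually fun v hv ↦ ?_
    have hc : Continuous fun z : (F →L[ℝ] F →L[ℝ] ℝ) × F ↦ z.1 z.2 z.2 := by fun_prop
    refine hc.continuousAt.eventually_mem (lt_mem_nhds (h v ?_))
    rintro rfl
    simp at hv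
  filter_upwards [hK] with b hb v hv
  have h1 := hb (‖v‖⁻¹ • v) (by simp [norm_smul, hv])
  have h2 : b v v = ‖v‖ * ‖v‖ * b (‖v‖⁻¹ • v) (‖v‖⁻¹ • v) := by
    have : ‖v‖ ≠ 0 := norm_ne_zero_iff.2 hv
    simp only [map_smul, smul_apply, smul_eq_mul]
    field_simp
  rw [h2]
  have : 0 < ‖v‖ := norm_pos_iff.2 hv
  positivity

/-- The solution of a smooth family of invertible linear equations is smooth. -/
lemma contMDiffAt_of_comp_eq {G W : Type*} [NormedAddCommGroup G] [NormedSpace ℝ G]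
    [FiniteDimensional ℝ G] [NormedAddCommGroup W] [NormedSpace ℝ W] {x₀ : M}
    {A : M → F →L[ℝ] G} {X : M → W →L[ℝ] F} {Y : M → W →L[ℝ] G}
    (hdim : Module.finrank ℝ F = Module.finrank ℝ G)
    (hA : ContMDiffAt 𝓘(ℝ, E) 𝓘(ℝ, F →L[ℝ] G) ∞ A x₀)
    (hinj : Function.Injective (A x₀))
    (hY : ContMDiffAt 𝓘(ℝ, E) 𝓘(ℝ, W →L[ℝ] G) ∞ Y x₀)
    (h : ∀ᶠ x in nhds x₀, (A x).comp (X x) = Y x) :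
    ContMDiffAt 𝓘(ℝ, E) 𝓘(ℝ, W →L[ℝ] F) ∞ X x₀ := by
  let e : F ≃L[ℝ] G := (LinearEquiv.ofInjectiveOfFinrankEq (A x₀).toLinearMap hinj
    hdim).toContinuousLinearEquiv
  have he : (e : F →L[ℝ] G) = A x₀ := by ext; rfl
  have : CompleteSpace F := FiniteDimensional.complete ℝ F
  have hinv : ContMDiffAt 𝓘(ℝ, E) 𝓘(ℝ, G →L[ℝ] F) ∞
      (fun x ↦ ContinuousLinearMap.inverse (A x)) x₀ := by
    have h1 := contDiffAt_map_inverse (n := ∞) e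
    rw [he] at h1
    exact h1.contMDiffAt.comp x₀ hA
  refine (hinv.clm_comp hY).congr_of_eventuallyEq ?_
  -- Invertible maps form an open set, so `X = A⁻¹ Y` throughout a neighbourhood.
  have hev : ∀ᶠ x in nhds x₀, A x ∈ Set.range ((↑) : (F ≃L[ℝ] G) → F →L[ℝ] G) :=
    hA.continuousAt.eventually_mem (he ▸ ContinuousLinearEquiv.nhds e)
  filter_upwards [h, hev] with x hx ⟨e', he'⟩
  rw [← hx, ← he', ContinuousLinearMap.inverse_equiv]
  ext w; simp

/-- The positive square root of a smooth family of positive operators is smooth. -/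
lemma contMDiffAt_of_isPosSqrt {x₀ : M} {G : M → F →L[ℝ] F →L[ℝ] ℝ} {Q P : M → F →L[ℝ] F}
    (hG : ContinuousAt G x₀) (hQ : ContMDiffAt 𝓘(ℝ, E) 𝓘(ℝ, F →L[ℝ] F) ∞ Q x₀)
    (h : ∀ᶠ x in nhds x₀, IsPosSqrt (toBilin (G x)) (Q x).toLinearMap (P x).toLinearMap) :
    ContMDiffAt 𝓘(ℝ, E) 𝓘(ℝ, F →L[ℝ] F) ∞ P x₀ := by
  have h₀ := h.self_of_nhds
  let D : (F →L[ℝ] F) →ₗ[ℝ] (F →L[ℝ] F) := LinearMap.mulLeft ℝ (P x₀) + LinearMap.mulRight ℝ (P x₀)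
  have hD (H : F →L[ℝ] F) : D H = P x₀ * H + H * P x₀ := rfl
  have hsq : P x₀ * P x₀ = Q x₀ := by
    ext v; exact LinearMap.congr_fun h₀.sq v
  -- `D` is the derivative of squaring at `P x₀`. If `PH + HP = 0`, then `H` commutes with `P² = Q`,
  -- hence with `P`; so `2PH = 0` and `H = 0`.
  have hinj : Function.Injective D := by
    refine (injective_iff_map_eq_zero D).2 fun H hH ↦ ?_
    rw [hD] at hH
    have h1 : H * Q x₀ = Q x₀ * H := by
      have h2 : H * P x₀ = -(P x₀ * H) := (neg_eq_of_add_eq_zero_right hH).symm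
      rw [← hsq, ← mul_assoc, h2, neg_mul, mul_assoc, h2, mul_neg, neg_neg, mul_assoc]
    have h3 : H.toLinearMap ∘ₗ (P x₀).toLinearMap = (P x₀).toLinearMap ∘ₗ H.toLinearMap :=
      h₀.comm _ (LinearMap.ext fun v ↦ congrArg (· v) h1)
    ext v
    by_contra hne
    have h4 := h₀.pos (H v) hne
    have h5 : P x₀ (H v) + H (P x₀ v) = 0 := congrArg (· v) hH
    have h6 : H (P x₀ v) = P x₀ (H v) := LinearMap.congr_fun h3 v
    rw [h6, ← two_smul ℝ, smul_eq_zero] at h5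
    have h7 : (P x₀).toLinearMap (H v) = 0 := by simpa using h5
    simp [h7] at h4
  let D' : (F →L[ℝ] F) ≃L[ℝ] (F →L[ℝ] F) :=
    (LinearEquiv.ofInjectiveEndo D hinj).toContinuousLinearEquiv
  have hf : ContDiffAt ℝ ∞ (fun X : F →L[ℝ] F ↦ X * X) (P x₀) := contDiffAt_id.mul contDiffAt_id
  have hf' : HasFDerivAt (fun X : F →L[ℝ] F ↦ X * X) (D' : (F →L[ℝ] F) →L[ℝ] (F →L[ℝ] F))
      (P x₀) := by
    have h1 := (hasFDerivAt_id (𝕜 := ℝ) (P x₀)).mul' (hasFDerivAt_id (𝕜 := ℝ) (P x₀))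
    refine h1.congr_fderiv ?_
    ext H v
    simp [D', D]
  set ψ := hf.localInverse hf' (by simp) with hψ
  have hψs : ContDiffAt ℝ ∞ ψ (Q x₀) := by
    have := hf.to_localInverse hf' (by simp)
    rwa [hsq] at this
  have hψ₀ : ψ (Q x₀) = P x₀ := by
    have := hf.localInverse_apply_image hf' (by simp)
    rwa [hsq] at this
  have hψr : ∀ᶠ Y in nhds (Q x₀), ψ Y * ψ Y = Y := by
    have := (hf.hasStrictFDerivAt' hf' (by simp)).eventually_right_inverse
    rwa [hsq] at this
  have hR : ContMDiffAt 𝓘(ℝ, E) 𝓘(ℝ, F →L[ℝ] F) ∞ (fun x ↦ ψ (Q x)) x₀ :=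
    hψs.contMDiffAt.comp x₀ hQ
  refine hR.congr_of_eventuallyEq ?_
  -- The smooth local root `ψ (Q x)` equals `P x₀` at `x₀`, so it stays positive nearby and
  -- uniqueness identifies it with `P x`.
  have hpos : ∀ᶠ x in nhds x₀, ∀ v ≠ 0, 0 < ((G x).comp (ψ (Q x))) v v := by
    have hc : ContinuousAt (fun x ↦ (G x).comp (ψ (Q x))) x₀ := hG.clm_comp hR.continuousAt
    refine hc.eventually (eventually_pos_of_pos fun v hv ↦ ?_)
    change 0 < G x₀ (ψ (Q x₀) v) v
    rw [hψ₀]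
    exact h₀.pos v hv
  filter_upwards [h, hpos, hQ.continuousAt.eventually hψr] with x hx hxp hxr
  have := hx.unique (R := (ψ (Q x)).toLinearMap) (LinearMap.ext fun v ↦ congrArg (· v) hxr) hxp
  ext v
  exact (LinearMap.congr_fun this v).symm

end Smooth

/-! ### The compatible structure on one tangent space. -/

section Adapted

variable {V : Type*} [AddCommGroup V] [Module ℝ V]

lemma IsSplit.swap {a₁ a₂ : V →ₗ[ℝ] ℝ} {B₁ B₂ : V →ₗ[ℝ] V →ₗ[ℝ] ℝ} (h : IsSplit a₁ a₂ B₁ B₂) :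
    IsSplit a₂ a₁ B₂ B₁ where
  skew_fst := h.skew_snd
  skew_snd := h.skew_fst
  reeb_fst := let ⟨z, h1, h2, h3, h4⟩ := h.reeb_snd; ⟨z, h2, h1, h4, h3⟩
  reeb_snd := let ⟨z, h1, h2, h3, h4⟩ := h.reeb_fst; ⟨z, h2, h1, h4, h3⟩
  eq_zero v h1 h2 h3 h4 := h.eq_zero v h2 h1 h4 h3
  proj v := by
    obtain ⟨z, h1, h2, h3, h4⟩ := h.reeb_fst
    obtain ⟨z', h1', h2', h3', h4'⟩ := h.reeb_snd
    obtain ⟨u, hu1, hu2, hu3, hu4⟩ := h.proj v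
    -- Removing the other three components leaves the part in the second symplectic summand.
    exact ⟨v - u - a₁ v • z - a₂ v • z', by simp [*], by simp [*], by simp [*], by simp [*]⟩

variable [TopologicalSpace V]

variable (V) in
/-- The tensors that enter the construction of a compatible metric on a tangent space. -/
structure AdaptedData where
  (a₁ a₂ : V →L[ℝ] ℝ)
  (b₁ b₂ g₀ N g₁ g : V →L[ℝ] V →L[ℝ] ℝ)
  (z₁ z₂ : V)
  (p₁ p₂ A Q P φ : V →L[ℝ] V)

/-- The data obtained from `a₁, a₂, b₁, b₂` and the scalar product `g₀`: the Reeb vectors `zᵢ`, the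
projections `pᵢ` to the symplectic summands, a scalar product `g₁` for which the splitting is
orthogonal, and the polar decomposition `A = P φ` of the operator `A` representing `b₁ + b₂` in
`g₁`. -/
structure AdaptedData.IsAdapted (D : AdaptedData V) : Prop where
  N_apply (v w : V) : D.N v w = D.b₁ v w + D.b₂ v w + D.a₁ v * D.a₁ w + D.a₂ v * D.a₂ w
  N_inj (v : V) : D.N v = 0 → v = 0
  N_z₁ (w : V) : D.N D.z₁ w = D.a₁ w
  N_z₂ (w : V) : D.N D.z₂ w = D.a₂ w
  N_p₁ (v w : V) : D.N (D.p₁ v) w = D.b₁ v w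
  N_p₂ (v w : V) : D.N (D.p₂ v) w = D.b₂ v w
  g₁_apply (v w : V) : D.g₁ v w = D.a₁ v * D.a₁ w + D.a₂ v * D.a₂ w + D.g₀ (D.p₁ v) (D.p₁ w) +
    D.g₀ (D.p₂ v) (D.p₂ w)
  g₁_pos (v : V) : v ≠ 0 → 0 < D.g₁ v v
  g₁_A (v w : V) : D.g₁ (D.A v) w = -(D.b₁ v w + D.b₂ v w)
  Q_apply (v : V) : D.Q v = -D.A (D.A v) + D.a₁ v • D.z₁ + D.a₂ v • D.z₂
  sqrt : IsPosSqrt (toBilin D.g₁) D.Q.toLinearMap D.P.toLinearMap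
  P_φ (v : V) : D.P (D.φ v) = D.A v
  g_apply (v w : V) : D.g v w = D.g₁ (D.P v) w

/-- The data with the roles of the two forms exchanged. -/
def AdaptedData.swap (D : AdaptedData V) : AdaptedData V where
  a₁ := D.a₂
  a₂ := D.a₁
  b₁ := D.b₂
  b₂ := D.b₁
  z₁ := D.z₂
  z₂ := D.z₁
  p₁ := D.p₂
  p₂ := D.p₁
  g₀ := D.g₀
  N := D.N
  g₁ := D.g₁
  g := D.g
  A := D.A
  Q := D.Q
  P := D.P
  φ := D.φ

namespace AdaptedData.IsAdapted

variable {D : AdaptedData V}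

lemma swap (h : D.IsAdapted) : D.swap.IsAdapted where
  N_apply v w := by simp only [AdaptedData.swap, h.N_apply]; ring
  N_inj := h.N_inj
  N_z₁ := h.N_z₂
  N_z₂ := h.N_z₁
  N_p₁ := h.N_p₂
  N_p₂ := h.N_p₁
  g₁_apply v w := by simp only [AdaptedData.swap, h.g₁_apply]; ring
  g₁_pos := h.g₁_pos
  g₁_A v w := by simp only [AdaptedData.swap, h.g₁_A]; ring
  Q_apply v := by simp only [AdaptedData.swap, h.Q_apply]; abel
  sqrt := h.sqrt
  P_φ := h.P_φ
  g_apply := h.g_apply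

lemma N_ext (h : D.IsAdapted) {v v' : V} (hv : ∀ w, D.N v w = D.N v' w) : v = v' :=
  sub_eq_zero.1 <| h.N_inj _ <| by ext w; simp [hv]

variable (h : D.IsAdapted)
  (hs : IsSplit D.a₁.toLinearMap D.a₂.toLinearMap (toBilin D.b₁) (toBilin D.b₂))
include h hs

/-- `IsAdapted` records only the equation `N z₁ = a₁`, suited to smoothness. The Reeb vector of the
splitting solves it too, and `N` is injective. -/
lemma z₁_spec : D.a₁ D.z₁ = 1 ∧ D.a₂ D.z₁ = 0 ∧ (∀ w, D.b₁ D.z₁ w = 0) ∧ ∀ w, D.b₂ D.z₁ w = 0 := by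
  obtain ⟨z, h1, h2, h3, h4⟩ := hs.reeb_fst
  have h3' (w) : D.b₁ z w = 0 := LinearMap.congr_fun h3 w
  have h4' (w) : D.b₂ z w = 0 := LinearMap.congr_fun h4 w
  have h1' : D.a₁ z = 1 := h1
  have h2' : D.a₂ z = 0 := h2
  have : D.z₁ = z := h.N_ext fun w ↦ by simp [h.N_z₁, h.N_apply z, h1', h2', h3', h4']
  rw [this]
  exact ⟨h1, h2, h3', h4'⟩

lemma z₂_spec : D.a₂ D.z₂ = 1 ∧ D.a₁ D.z₂ = 0 ∧ (∀ w, D.b₂ D.z₂ w = 0) ∧ ∀ w, D.b₁ D.z₂ w = 0 :=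
  h.swap.z₁_spec hs.swap

lemma p₁_spec (v : V) : D.a₁ (D.p₁ v) = 0 ∧ D.a₂ (D.p₁ v) = 0 ∧
    (∀ w, D.b₁ (D.p₁ v) w = D.b₁ v w) ∧ ∀ w, D.b₂ (D.p₁ v) w = 0 := by
  obtain ⟨u, h1, h2, h3, h4⟩ := hs.proj v
  have h3' (w) : D.b₁ u w = D.b₁ v w := LinearMap.congr_fun h3 w
  have h4' (w) : D.b₂ u w = 0 := LinearMap.congr_fun h4 w
  have h1' : D.a₁ u = 0 := h1
  have h2' : D.a₂ u = 0 := h2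
  have : D.p₁ v = u := h.N_ext fun w ↦ by simp [h.N_p₁, h.N_apply u, h1', h2', h3', h4']
  rw [this]
  exact ⟨h1, h2, h3', h4'⟩

lemma p₁_p₁ (v : V) : D.p₁ (D.p₁ v) = D.p₁ v :=
  h.N_ext fun w ↦ by rw [h.N_p₁, h.N_p₁, (h.p₁_spec hs v).2.2.1]

lemma p₂_p₁ (v : V) : D.p₂ (D.p₁ v) = 0 :=
  h.N_ext fun w ↦ by rw [h.N_p₂, (h.p₁_spec hs v).2.2.2]; simp

lemma p₁_z₁ : D.p₁ D.z₁ = 0 :=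
  h.N_ext fun w ↦ by rw [h.N_p₁, (h.z₁_spec hs).2.2.1]; simp

lemma p₁_z₂ : D.p₁ D.z₂ = 0 :=
  h.N_ext fun w ↦ by rw [h.N_p₁, (h.z₂_spec hs).2.2.2]; simp

lemma p₂_z₁ : D.p₂ D.z₁ = 0 := h.swap.p₁_z₂ hs.swap

lemma g₁_z₁ (w : V) : D.g₁ D.z₁ w = D.a₁ w := by
  simp [h.g₁_apply, h.z₁_spec hs, h.p₁_z₁ hs, h.p₂_z₁ hs]

omit hs in
lemma g₁_ext {v v' : V} (hv : ∀ w, D.g₁ v w = D.g₁ v' w) : v = v' := by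
  by_contra hne
  have := h.g₁_pos _ (sub_ne_zero.2 hne)
  simp [hv] at this

omit hs in
lemma P_inj {v : V} (hv : D.P v = 0) : v = 0 := by
  by_contra hne
  have := h.sqrt.pos v hne
  simp [hv] at this

lemma A_z₁ : D.A D.z₁ = 0 :=
  h.g₁_ext fun w ↦ by simp [h.g₁_A, h.z₁_spec hs]

lemma A_z₂ : D.A D.z₂ = 0 := h.swap.A_z₁ hs.swap

lemma Q_z₁ : D.Q D.z₁ = D.z₁ := by
  simp [h.Q_apply, h.A_z₁ hs, h.z₁_spec hs]

/-- Since `P² z₁ = z₁`, the difference `P z₁ - z₁` would be an eigenvector of `P` with eigenvalue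
`-1`, against positivity. -/
lemma P_z₁ : D.P D.z₁ = D.z₁ := by
  by_contra hne
  have h1 := h.sqrt.pos _ (sub_ne_zero.2 hne)
  have h2 := h.g₁_pos _ (sub_ne_zero.2 hne)
  have h3 : D.P (D.P D.z₁) = D.z₁ := (LinearMap.congr_fun h.sqrt.sq D.z₁).trans (h.Q_z₁ hs)
  have h4 : D.P (D.P D.z₁ - D.z₁) = -(D.P D.z₁ - D.z₁) := by rw [map_sub, h3]; abel
  simp only [ContinuousLinearMap.coe_coe, toBilin_apply] at h1
  rw [h4] at h1
  simp only [map_neg, neg_apply] at h1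
  linarith

lemma φ_z₁ : D.φ D.z₁ = 0 := h.P_inj (by rw [h.P_φ, h.A_z₁ hs])

lemma φ_z₂ : D.φ D.z₂ = 0 := h.swap.φ_z₁ hs.swap

section Symm

variable (hsymm : ∀ v w, D.g₀ v w = D.g₀ w v)
include hsymm

omit hs in
lemma g₁_symm (v w : V) : D.g₁ v w = D.g₁ w v := by
  rw [h.g₁_apply, h.g₁_apply, hsymm (D.p₁ v), hsymm (D.p₂ v)]; ring

omit hs in
lemma g_symm (v w : V) : D.g v w = D.g w v := by
  rw [h.g_apply, h.g_apply, h.g₁_symm hsymm (D.P w)]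
  exact h.sqrt.symm v w

omit hs hsymm in
lemma g_pos {v : V} (hv : v ≠ 0) : 0 < D.g v v := by
  rw [h.g_apply]; exact h.sqrt.pos v hv

lemma g₁_A_right (v w : V) : D.g₁ v (D.A w) = D.b₁ v w + D.b₂ v w := by
  have h1 : D.b₁ w v = -D.b₁ v w := hs.skew_fst w v
  have h2 : D.b₂ w v = -D.b₂ v w := hs.skew_snd w v
  rw [h.g₁_symm hsymm, h.g₁_A, h1, h2]; ring

lemma g_φ (v w : V) : D.g v (D.φ w) = D.b₁ v w + D.b₂ v w := by
  have h1 : D.g₁ (D.P v) (D.φ w) = D.g₁ v (D.P (D.φ w)) := h.sqrt.symm v (D.φ w)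
  rw [h.g_apply, h1, h.P_φ, h.g₁_A_right hs hsymm]

lemma a₁_P (v : V) : D.a₁ (D.P v) = D.a₁ v := by
  have h1 : D.g₁ (D.P v) D.z₁ = D.g₁ v (D.P D.z₁) := h.sqrt.symm v D.z₁
  rw [← h.g₁_z₁ hs, h.g₁_symm hsymm, h1, h.P_z₁ hs, h.g₁_symm hsymm, h.g₁_z₁ hs]

lemma g_z₁ (v : V) : D.g v D.z₁ = D.a₁ v := by
  rw [h.g_apply, h.g₁_symm hsymm, h.g₁_z₁ hs, h.a₁_P hs hsymm]

lemma g_z₂ (v : V) : D.g v D.z₂ = D.a₂ v := h.swap.g_z₁ hs.swap hsymm v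

lemma a₁_A (v : V) : D.a₁ (D.A v) = 0 := by
  rw [← h.g₁_z₁ hs, h.g₁_A_right hs hsymm, (h.z₁_spec hs).2.2.1, (h.z₁_spec hs).2.2.2, add_zero]

lemma a₂_A (v : V) : D.a₂ (D.A v) = 0 := h.swap.a₁_A hs.swap hsymm v

lemma a₁_φ (v : V) : D.a₁ (D.φ v) = 0 := by
  rw [← h.a₁_P hs hsymm, h.P_φ, h.a₁_A hs hsymm]

lemma P_A (v : V) : D.P (D.A v) = D.A (D.P v) := by
  have hQ : D.A.toLinearMap ∘ₗ D.Q.toLinearMap = D.Q.toLinearMap ∘ₗ D.A.toLinearMap := by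
    ext v
    simp [h.Q_apply, h.A_z₁ hs, h.A_z₂ hs, h.a₁_A hs hsymm, h.a₂_A hs hsymm]
  exact (LinearMap.congr_fun (h.sqrt.comm _ hQ) v).symm

/-- Apply the injective `P²`: the left side becomes `A² v` because `P` and `A` commute, the right
side because `Q = P²` and `A` kills the Reeb vectors. -/
lemma φ_φ (v : V) : D.φ (D.φ v) = -v + D.a₁ v • D.z₁ + D.a₂ v • D.z₂ := by
  have hPP (u : V) : D.P (D.P u) = D.Q u := LinearMap.congr_fun h.sqrt.sq u
  refine sub_eq_zero.1 (h.P_inj (h.P_inj ?_))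
  have h1 : D.P (D.P (D.φ (D.φ v))) = D.A (D.A v) := by
    rw [h.P_φ, h.P_A hs hsymm, h.P_φ]
  rw [map_sub, map_sub, h1, hPP, h.Q_apply]
  simp [h.A_z₁ hs, h.A_z₂ hs, h.z₁_spec hs, h.z₂_spec hs]

omit hsymm in
lemma g₁_p₁ (v w : V) : D.g₁ (D.p₁ v) w = D.g₁ v (D.p₁ w) := by
  simp [h.g₁_apply, h.p₁_spec hs, h.p₁_p₁ hs, h.p₂_p₁ hs]

-- Against any `w`, both sides have `g₁`-product `-b₁ v w`.
omit hsymm in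
lemma p₁_A (v : V) : D.p₁ (D.A v) = D.A (D.p₁ v) := by
  refine h.g₁_ext fun w ↦ ?_
  have h1 : D.b₁ v (D.p₁ w) = -D.b₁ (D.p₁ w) v := hs.skew_fst _ _
  have h2 : D.b₂ v (D.p₁ w) = -D.b₂ (D.p₁ w) v := hs.skew_snd _ _
  have h3 : D.b₁ w v = -D.b₁ v w := hs.skew_fst _ _
  rw [h.g₁_p₁ hs, h.g₁_A, h.g₁_A, h1, h2, (h.p₁_spec hs w).2.2.1, (h.p₁_spec hs w).2.2.2,
    (h.p₁_spec hs v).2.2.1, (h.p₁_spec hs v).2.2.2, h3]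
  ring

omit hsymm in
lemma p₁_φ (v : V) : D.p₁ (D.φ v) = D.φ (D.p₁ v) := by
  have hQ : D.p₁.toLinearMap ∘ₗ D.Q.toLinearMap = D.Q.toLinearMap ∘ₗ D.p₁.toLinearMap := by
    ext v
    simp [h.Q_apply, h.p₁_z₁ hs, h.p₁_z₂ hs, h.p₁_A hs, h.p₁_spec hs]
  have hP (v : V) : D.p₁ (D.P v) = D.P (D.p₁ v) := LinearMap.congr_fun (h.sqrt.comm _ hQ) v
  refine sub_eq_zero.1 (h.P_inj ?_)
  rw [map_sub, ← hP, h.P_φ, h.P_φ, h.p₁_A hs, sub_self]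

-- Through `N`, the kernel of `b₁` is the kernel of `p₁`, which commutes with `φ`.
omit hsymm in
lemma b₁_φ {v : V} (hv : ∀ w, D.b₁ v w = 0) (w : V) : D.b₁ (D.φ v) w = 0 := by
  have h1 : D.p₁ v = 0 := h.N_ext fun w ↦ by simp [h.N_p₁, hv]
  rw [← h.N_p₁, h.p₁_φ hs, h1]; simp

end Symm

end AdaptedData.IsAdapted

variable [IsTopologicalAddGroup V] [ContinuousSMul ℝ V] [T2Space V] [FiniteDimensional ℝ V]

lemma exists_comp_eq {b : V →L[ℝ] V →L[ℝ] ℝ} (hb : ∀ v, b v = 0 → v = 0)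
    (t : V →L[ℝ] V →L[ℝ] ℝ) : ∃ p : V →L[ℝ] V, ∀ v w, b (p v) w = t v w := by
  have hinj : Function.Injective (toBilin b) :=
    (injective_iff_map_eq_zero _).2 fun v hv ↦ hb v (by ext w; exact LinearMap.congr_fun hv w)
  let e := LinearEquiv.ofInjectiveOfFinrankEq (toBilin b) hinj
    (Subspace.dual_finrank_eq (K := ℝ) (V := V)).symm
  refine ⟨LinearMap.toContinuousLinearMap (e.symm.toLinearMap ∘ₗ toBilin t), fun v w ↦ ?_⟩
  exact LinearMap.congr_fun (e.apply_symm_apply (toBilin t v)) w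

lemma exists_isAdapted {a₁ a₂ : V →L[ℝ] ℝ} {b₁ b₂ g₀ : V →L[ℝ] V →L[ℝ] ℝ}
    (hs : IsSplit a₁.toLinearMap a₂.toLinearMap (toBilin b₁) (toBilin b₂))
    (hsymm : ∀ v w, g₀ v w = g₀ w v) (hpos : ∀ v ≠ 0, 0 < g₀ v v) :
    ∃ D : AdaptedData V, D.IsAdapted ∧ D.a₁ = a₁ ∧ D.a₂ = a₂ ∧ D.b₁ = b₁ ∧ D.b₂ = b₂ ∧
      D.g₀ = g₀ := by
  have skew₁ (v w : V) : b₁ v w = -b₁ w v := hs.skew_fst v w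
  have skew₂ (v w : V) : b₂ v w = -b₂ w v := hs.skew_snd v w
  let N : V →L[ℝ] V →L[ℝ] ℝ := b₁ + b₂ + a₁.smulRight a₁ + a₂.smulRight a₂
  have hN (v w : V) : N v w = b₁ v w + b₂ v w + a₁ v * a₁ w + a₂ v * a₂ w := by simp [N]
  obtain ⟨z₁, h11, h12, h13, h14⟩ := hs.reeb_fst
  obtain ⟨z₂, h21, h22, h23, h24⟩ := hs.reeb_snd
  simp only [ContinuousLinearMap.coe_coe] at h11 h12 h21 h22
  have h13' (w) : b₁ z₁ w = 0 := LinearMap.congr_fun h13 w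
  have h14' (w) : b₂ z₁ w = 0 := LinearMap.congr_fun h14 w
  have h23' (w) : b₁ z₂ w = 0 := LinearMap.congr_fun h23 w
  have h24' (w) : b₂ z₂ w = 0 := LinearMap.congr_fun h24 w
  have hNinj (v : V) (hv : ∀ w, N v w = 0) : v = 0 := by
    have e1 : a₁ v = 0 := by
      simpa [hN, skew₁ v z₁, skew₂ v z₁, h13', h14', h11, h12] using hv z₁
    have e2 : a₂ v = 0 := by
      simpa [hN, skew₁ v z₂, skew₂ v z₂, h23', h24', h21, h22] using hv z₂
    have e3 (w : V) : b₁ v w = 0 := by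
      -- Testing on the first symplectic component of `w` isolates `b₁` from `b₂`.
      obtain ⟨u, hu1, hu2, hu3, hu4⟩ := hs.proj w
      have hu3' : b₁ u v = b₁ w v := LinearMap.congr_fun hu3 v
      have hu4' : b₂ u v = 0 := LinearMap.congr_fun hu4 v
      have := hv u
      rw [hN, e1, e2, skew₂ v u, hu4', skew₁ v u, hu3', ← skew₁ v w] at this
      simpa using this
    have e4 (w : V) : b₂ v w = 0 := by simpa [hN, e1, e2, e3] using hv w
    exact hs.eq_zero v e1 e2 (LinearMap.ext e3) (LinearMap.ext e4)
  have hNinj' (v : V) (hv : N v = 0) : v = 0 := hNinj v fun w ↦ by rw [hv]; rfl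
  obtain ⟨p₁, hp₁⟩ := exists_comp_eq hNinj' b₁
  obtain ⟨p₂, hp₂⟩ := exists_comp_eq hNinj' b₂
  have hp₁z₁ : p₁ z₁ = 0 := hNinj _ fun w ↦ by rw [hp₁, h13']
  have hp₁z₂ : p₁ z₂ = 0 := hNinj _ fun w ↦ by rw [hp₁, h23']
  have hp₂z₁ : p₂ z₁ = 0 := hNinj _ fun w ↦ by rw [hp₂, h14']
  have hp₂z₂ : p₂ z₂ = 0 := hNinj _ fun w ↦ by rw [hp₂, h24']
  let g₁ : V →L[ℝ] V →L[ℝ] ℝ := a₁.smulRight a₁ + a₂.smulRight a₂ +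
    ((ContinuousLinearMap.precomp ℝ p₁).comp g₀).comp p₁ +
    ((ContinuousLinearMap.precomp ℝ p₂).comp g₀).comp p₂
  have hg₁ (v w : V) : g₁ v w = a₁ v * a₁ w + a₂ v * a₂ w + g₀ (p₁ v) (p₁ w) +
    g₀ (p₂ v) (p₂ w) := by simp [g₁]
  have hg₁symm (v w : V) : g₁ v w = g₁ w v := by
    rw [hg₁, hg₁, hsymm (p₁ v), hsymm (p₂ v)]; ring
  have hnonneg (v : V) : 0 ≤ g₀ v v := by
    rcases eq_or_ne v 0 with rfl | hv
    · simp
    · exact (hpos v hv).le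
  have hg₁nonneg (v : V) : 0 ≤ g₁ v v := by
    rw [hg₁]
    have := mul_self_nonneg (a₁ v)
    have := mul_self_nonneg (a₂ v)
    have := hnonneg (p₁ v)
    have := hnonneg (p₂ v)
    positivity
  have hg₁pos (v : V) (hv : v ≠ 0) : 0 < g₁ v v := by
    refine (hg₁nonneg v).lt_of_ne' fun h0 ↦ hv ?_
    rw [hg₁] at h0
    have i1 := mul_self_nonneg (a₁ v)
    have i2 := mul_self_nonneg (a₂ v)
    have i3 := hnonneg (p₁ v)
    have i4 := hnonneg (p₂ v)
    have e1 : a₁ v = 0 := mul_self_eq_zero.1 (by linarith)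
    have e2 : a₂ v = 0 := mul_self_eq_zero.1 (by linarith)
    have e3 : p₁ v = 0 := by
      by_contra hne
      linarith [hpos _ hne]
    have e4 : p₂ v = 0 := by
      by_contra hne
      linarith [hpos _ hne]
    refine hNinj v fun w ↦ ?_
    rw [hN, e1, e2, ← hp₁, ← hp₂, e3, e4]
    simp
  have hg₁inj (v : V) (hv : g₁ v = 0) : v = 0 := by
    by_contra hne
    simpa [hv] using hg₁pos v hne
  -- The sign gives `g₁ v (A w) = b₁ v w + b₂ v w`, matching `g(X, φY) = (dα₁ + dα₂)(X, Y)`.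
  obtain ⟨A, hA⟩ := exists_comp_eq hg₁inj (-(b₁ + b₂))
  replace hA (v w : V) : g₁ (A v) w = -(b₁ v w + b₂ v w) := by
    rw [hA]; simp only [neg_apply, add_apply]
  let Q : V →L[ℝ] V := -(A.comp A) + a₁.smulRight z₁ + a₂.smulRight z₂
  have hQ (v : V) : Q v = -A (A v) + a₁ v • z₁ + a₂ v • z₂ := by simp [Q]
  -- `A` is `g₁`-skew, which makes `Q` symmetric and nonnegative; the terms in `a₁, a₂` make it
  -- definite on `ker A`.
  have hgQ (v w : V) : g₁ (Q v) w = g₁ (A v) (A w) + a₁ v * a₁ w + a₂ v * a₂ w := by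
    have e1 : g₁ (A (A v)) w = -g₁ (A v) (A w) := by
      rw [hA, hg₁symm (A v), hA, skew₁ _ w, skew₂ _ w]; ring
    have e2 : g₁ z₁ w = a₁ w := by simp [hg₁, h11, h12, hp₁z₁, hp₂z₁]
    have e3 : g₁ z₂ w = a₂ w := by simp [hg₁, h21, h22, hp₁z₂, hp₂z₂]
    simp [hQ, e1, e2, e3]
  have hgQpos (v : V) (hv : v ≠ 0) : 0 < g₁ (Q v) v := by
    rw [hgQ]
    have i1 := mul_self_nonneg (a₁ v)
    have i2 := mul_self_nonneg (a₂ v)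
    have i3 := hg₁nonneg (A v)
    refine lt_of_le_of_ne (by positivity) fun h0 ↦ hv ?_
    have e1 : a₁ v = 0 := mul_self_eq_zero.1 (by linarith)
    have e2 : a₂ v = 0 := mul_self_eq_zero.1 (by linarith)
    have e3 : A v = 0 := by
      by_contra hne
      linarith [hg₁pos _ hne]
    refine hNinj v fun w ↦ ?_
    have := hA v w
    rw [e3] at this
    simp only [map_zero, zero_apply] at this
    rw [hN, e1, e2]
    linarith
  obtain ⟨P, hP⟩ := exists_isPosSqrt (G := toBilin g₁) hg₁symm hg₁pos (Q := Q.toLinearMap)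
    (fun v w ↦ by
      simp only [toBilin_apply, ContinuousLinearMap.coe_coe]
      rw [hg₁symm v, hgQ, hgQ, hg₁symm (A v)]; ring) hgQpos
  have hPinj : Function.Injective P := by
    refine (injective_iff_map_eq_zero P).2 fun v hv ↦ ?_
    by_contra hne
    simpa [hv] using hP.pos v hne
  let e := LinearEquiv.ofInjectiveEndo P hPinj
  let D : AdaptedData V :=
    { a₁ := a₁, a₂ := a₂, b₁ := b₁, b₂ := b₂, g₀ := g₀, N := N, g₁ := g₁, z₁ := z₁, z₂ := z₂
      p₁ := p₁, p₂ := p₂, A := A, Q := Q, P := LinearMap.toContinuousLinearMap P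
      g := g₁.comp (LinearMap.toContinuousLinearMap P)
      φ := LinearMap.toContinuousLinearMap (e.symm.toLinearMap ∘ₗ A.toLinearMap) }
  refine ⟨D, ?_, rfl, rfl, rfl, rfl, rfl⟩
  exact
    { N_apply := hN
      N_inj := hNinj'
      N_z₁ := fun w ↦ by simp [D, hN, h11, h12, h13', h14']
      N_z₂ := fun w ↦ by simp [D, hN, h21, h22, h23', h24']
      N_p₁ := hp₁
      N_p₂ := hp₂
      g₁_apply := hg₁
      g₁_pos := hg₁pos
      g₁_A := hA
      Q_apply := hQ
      sqrt := hP
      P_φ := fun v ↦ e.apply_symm_apply (A v)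
      g_apply := fun v w ↦ rfl }

end Adapted

/-! ### Transport to a fixed vector space. -/

section Transport

variable {V W : Type*} [AddCommGroup V] [Module ℝ V] [TopologicalSpace V]
  [AddCommGroup W] [Module ℝ W] [TopologicalSpace W]

/-- The pullback of a bilinear form by a linear map. -/
def pullBilin (S : W →L[ℝ] V) (b : V →L[ℝ] V →L[ℝ] ℝ) : W →L[ℝ] W →L[ℝ] ℝ :=
  ((ContinuousLinearMap.precomp ℝ S).comp b).comp S

@[simp]
lemma pullBilin_apply (S : W →L[ℝ] V) (b : V →L[ℝ] V →L[ℝ] ℝ) (v w : W) :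
    pullBilin S b v w = b (S v) (S w) := rfl

/-- Transport of the data along an isomorphism `C` with inverse `S`. -/
def AdaptedData.conj (C : V →L[ℝ] W) (S : W →L[ℝ] V) (D : AdaptedData V) : AdaptedData W where
  a₁ := D.a₁.comp S
  a₂ := D.a₂.comp S
  b₁ := pullBilin S D.b₁
  b₂ := pullBilin S D.b₂
  g₀ := pullBilin S D.g₀
  N := pullBilin S D.N
  g₁ := pullBilin S D.g₁
  g := pullBilin S D.g
  z₁ := C D.z₁
  z₂ := C D.z₂
  p₁ := (C.comp D.p₁).comp S
  p₂ := (C.comp D.p₂).comp S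
  A := (C.comp D.A).comp S
  Q := (C.comp D.Q).comp S
  P := (C.comp D.P).comp S
  φ := (C.comp D.φ).comp S

/-- This carries data on the varying tangent spaces to the model space, where smoothness is a
statement about maps into fixed spaces. -/
lemma AdaptedData.IsAdapted.conj {C : V →L[ℝ] W} {S : W →L[ℝ] V} {D : AdaptedData V}
    (hCS : ∀ w, C (S w) = w) (hSC : ∀ v, S (C v) = v) (h : D.IsAdapted) :
    (D.conj C S).IsAdapted where
  N_apply v w := by simp [AdaptedData.conj, h.N_apply]
  N_inj v hv := by
    have : D.N (S v) = 0 := by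
      ext w
      have := congrArg (· (C w)) hv
      simpa [AdaptedData.conj, hSC] using this
    rw [← hCS v, h.N_inj _ this, map_zero]
  N_z₁ w := by simp [AdaptedData.conj, h.N_z₁, hSC]
  N_z₂ w := by simp [AdaptedData.conj, h.N_z₂, hSC]
  N_p₁ v w := by simp [AdaptedData.conj, h.N_p₁, hSC]
  N_p₂ v w := by simp [AdaptedData.conj, h.N_p₂, hSC]
  g₁_apply v w := by simp [AdaptedData.conj, h.g₁_apply, hSC]
  g₁_pos v hv := h.g₁_pos (S v) fun (h0 : S v = 0) ↦ hv (by rw [← hCS v, h0, map_zero])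
  g₁_A v w := by simp [AdaptedData.conj, h.g₁_A, hSC]
  Q_apply v := by simp [AdaptedData.conj, h.Q_apply, hSC]
  sqrt :=
    { sq := by
        ext v
        have (v : V) : D.P (D.P v) = D.Q v := LinearMap.congr_fun h.sqrt.sq v
        simp [AdaptedData.conj, hSC, this]
      symm := fun v w ↦ by
        have (v w : V) : D.g₁ (D.P v) w = D.g₁ v (D.P w) := h.sqrt.symm v w
        simp [AdaptedData.conj, hSC, this]
      pos := fun v hv ↦ by
        have := h.sqrt.pos (S v) fun (h0 : S v = 0) ↦ hv (by rw [← hCS v, h0, map_zero])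
        simpa [AdaptedData.conj, hSC] using this
      comm := fun T hT ↦ by
        have hT' := h.sqrt.comm (S.toLinearMap ∘ₗ T ∘ₗ C.toLinearMap) (by
          ext v
          have := congrArg S (LinearMap.congr_fun hT (C v))
          simpa [AdaptedData.conj, hSC] using this)
        ext w
        have := congrArg C (LinearMap.congr_fun hT' (S w))
        simpa [AdaptedData.conj, hCS] using this }
  P_φ v := by simp [AdaptedData.conj, h.P_φ, hSC]
  g_apply v w := by simp [AdaptedData.conj, h.g_apply, hSC]

end Transport

/-! ### Smoothness of the adapted tensors. -/

section SmoothData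

variable {E : Type*} [NormedAddCommGroup E] [NormedSpace ℝ E]
  {F : Type*} [NormedAddCommGroup F] [NormedSpace ℝ F]
  {M : Type*} [TopologicalSpace M] [ChartedSpace E M] {x₀ : M}

lemma contMDiffAt_smulRight {G : Type*} [NormedAddCommGroup G] [NormedSpace ℝ G]
    {a : M → F →L[ℝ] ℝ} {v : M → G} (ha : ContMDiffAt 𝓘(ℝ, E) 𝓘(ℝ, F →L[ℝ] ℝ) ∞ a x₀)
    (hv : ContMDiffAt 𝓘(ℝ, E) 𝓘(ℝ, G) ∞ v x₀) :
    ContMDiffAt 𝓘(ℝ, E) 𝓘(ℝ, F →L[ℝ] G) ∞ (fun x ↦ (a x).smulRight (v x)) x₀ :=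
  have h : ContDiff ℝ ∞ fun q : (F →L[ℝ] ℝ) × G ↦ q.1.smulRight q.2 :=
    contDiff_fst.smulRight contDiff_snd
  h.contMDiff.contMDiffAt.comp x₀ (ha.prodMk_space hv)

set_option synthInstance.maxHeartbeats 200000 in
lemma contMDiffAt_pullBilin {G : Type*} [NormedAddCommGroup G] [NormedSpace ℝ G]
    {S : M → G →L[ℝ] F} {b : M → F →L[ℝ] F →L[ℝ] ℝ}
    (hS : ContMDiffAt 𝓘(ℝ, E) 𝓘(ℝ, G →L[ℝ] F) ∞ S x₀)
    (hb : ContMDiffAt 𝓘(ℝ, E) 𝓘(ℝ, F →L[ℝ] F →L[ℝ] ℝ) ∞ b x₀) :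
    ContMDiffAt 𝓘(ℝ, E) 𝓘(ℝ, G →L[ℝ] G →L[ℝ] ℝ) ∞ (fun x ↦ pullBilin (S x) (b x)) x₀ :=
  have h : ContDiff ℝ ∞ fun S : G →L[ℝ] F ↦ ContinuousLinearMap.precomp ℝ S :=
    (IsLinearMap.with_bound ⟨fun _ _ ↦ by ext; simp, fun _ _ ↦ by ext; simp⟩ 1 fun S ↦
      ContinuousLinearMap.opNorm_le_bound _ (by positivity) fun a ↦ by
        simpa [mul_comm] using a.opNorm_comp_le S).contDiff
  have h1 : ContMDiffAt 𝓘(ℝ, E) 𝓘(ℝ, (F →L[ℝ] ℝ) →L[ℝ] G →L[ℝ] ℝ) ∞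
      (fun x ↦ ContinuousLinearMap.precomp ℝ (S x)) x₀ := h.contMDiff.contMDiffAt.comp x₀ hS
  (h1.clm_comp hb).clm_comp hS

variable [FiniteDimensional ℝ F]

lemma finrank_continuousDual : Module.finrank ℝ F = Module.finrank ℝ (F →L[ℝ] ℝ) := by
  rw [← (LinearMap.toContinuousLinearMap (𝕜 := ℝ) (E := F) (F' := ℝ)).finrank_eq]
  exact (Subspace.dual_finrank_eq (K := ℝ) (V := F)).symm

/-- The tensors obtained from smooth `a₁, a₂, b₁, b₂, g₀` are smooth. -/
lemma contMDiffAt_of_isAdapted {D : M → AdaptedData F}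
    (hD : ∀ᶠ x in nhds x₀, (D x).IsAdapted)
    (ha₁ : ContMDiffAt 𝓘(ℝ, E) 𝓘(ℝ, F →L[ℝ] ℝ) ∞ (fun x ↦ (D x).a₁) x₀)
    (ha₂ : ContMDiffAt 𝓘(ℝ, E) 𝓘(ℝ, F →L[ℝ] ℝ) ∞ (fun x ↦ (D x).a₂) x₀)
    (hb₁ : ContMDiffAt 𝓘(ℝ, E) 𝓘(ℝ, F →L[ℝ] F →L[ℝ] ℝ) ∞ (fun x ↦ (D x).b₁) x₀)
    (hb₂ : ContMDiffAt 𝓘(ℝ, E) 𝓘(ℝ, F →L[ℝ] F →L[ℝ] ℝ) ∞ (fun x ↦ (D x).b₂) x₀)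
    (hg₀ : ContMDiffAt 𝓘(ℝ, E) 𝓘(ℝ, F →L[ℝ] F →L[ℝ] ℝ) ∞ (fun x ↦ (D x).g₀) x₀) :
    ContMDiffAt 𝓘(ℝ, E) 𝓘(ℝ, F) ∞ (fun x ↦ (D x).z₁) x₀ ∧
    ContMDiffAt 𝓘(ℝ, E) 𝓘(ℝ, F) ∞ (fun x ↦ (D x).z₂) x₀ ∧
    ContMDiffAt 𝓘(ℝ, E) 𝓘(ℝ, F →L[ℝ] F) ∞ (fun x ↦ (D x).φ) x₀ ∧
    ContMDiffAt 𝓘(ℝ, E) 𝓘(ℝ, F →L[ℝ] F →L[ℝ] ℝ) ∞ (fun x ↦ (D x).g) x₀ := by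
  have h₀ := hD.self_of_nhds
  have hdim := finrank_continuousDual (F := F)
  have hN : ContMDiffAt 𝓘(ℝ, E) 𝓘(ℝ, F →L[ℝ] F →L[ℝ] ℝ) ∞ (fun x ↦ (D x).N) x₀ := by
    refine (((hb₁.add hb₂).add (contMDiffAt_smulRight ha₁ ha₁)).add
      (contMDiffAt_smulRight ha₂ ha₂)).congr_of_eventuallyEq ?_
    filter_upwards [hD] with x hx
    ext v w
    simp [hx.N_apply]
  have hNinj : Function.Injective (D x₀).N := (injective_iff_map_eq_zero _).2 h₀.N_inj
  have hz (z : M → F) (a : M → F →L[ℝ] ℝ)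
      (ha : ContMDiffAt 𝓘(ℝ, E) 𝓘(ℝ, F →L[ℝ] ℝ) ∞ a x₀)
      (hz : ∀ᶠ x in nhds x₀, ∀ w, (D x).N (z x) w = a x w) :
      ContMDiffAt 𝓘(ℝ, E) 𝓘(ℝ, F) ∞ z x₀ := by
    -- A vector is treated as the linear map from `ℝ` taking `1` to it.
    have h1 := contMDiffAt_of_comp_eq (W := ℝ) hdim hN hNinj
      (X := fun x ↦ (1 : ℝ →L[ℝ] ℝ).smulRight (z x))
      (contMDiffAt_smulRight (contMDiffAt_const (c := (1 : ℝ →L[ℝ] ℝ))) ha) (by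
        filter_upwards [hz] with x hx
        ext w
        simp [hx])
    simpa using h1.clm_apply (contMDiffAt_const (c := (1 : ℝ)))
  have hz₁ := hz (fun x ↦ (D x).z₁) _ ha₁ (hD.mono fun x hx ↦ hx.N_z₁)
  have hz₂ := hz (fun x ↦ (D x).z₂) _ ha₂ (hD.mono fun x hx ↦ hx.N_z₂)
  have hp₁ : ContMDiffAt 𝓘(ℝ, E) 𝓘(ℝ, F →L[ℝ] F) ∞ (fun x ↦ (D x).p₁) x₀ :=
    contMDiffAt_of_comp_eq hdim hN hNinj hb₁ (by
      filter_upwards [hD] with x hx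
      ext v w
      exact hx.N_p₁ v w)
  have hp₂ : ContMDiffAt 𝓘(ℝ, E) 𝓘(ℝ, F →L[ℝ] F) ∞ (fun x ↦ (D x).p₂) x₀ :=
    contMDiffAt_of_comp_eq hdim hN hNinj hb₂ (by
      filter_upwards [hD] with x hx
      ext v w
      exact hx.N_p₂ v w)
  have hg₁ : ContMDiffAt 𝓘(ℝ, E) 𝓘(ℝ, F →L[ℝ] F →L[ℝ] ℝ) ∞ (fun x ↦ (D x).g₁) x₀ := by
    refine ((((contMDiffAt_smulRight ha₁ ha₁).add (contMDiffAt_smulRight ha₂ ha₂)).add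
      (contMDiffAt_pullBilin hp₁ hg₀)).add (contMDiffAt_pullBilin hp₂ hg₀)).congr_of_eventuallyEq ?_
    filter_upwards [hD] with x hx
    ext v w
    simp [hx.g₁_apply]
  have hg₁inj : Function.Injective (D x₀).g₁ := (injective_iff_map_eq_zero _).2 fun v hv ↦ by
    by_contra hne
    simpa [hv] using h₀.g₁_pos v hne
  have hA : ContMDiffAt 𝓘(ℝ, E) 𝓘(ℝ, F →L[ℝ] F) ∞ (fun x ↦ (D x).A) x₀ :=
    contMDiffAt_of_comp_eq hdim hg₁ hg₁inj (hb₁.add hb₂).neg (by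
      filter_upwards [hD] with x hx
      ext v w
      exact hx.g₁_A v w)
  have hQ : ContMDiffAt 𝓘(ℝ, E) 𝓘(ℝ, F →L[ℝ] F) ∞ (fun x ↦ (D x).Q) x₀ := by
    refine (((hA.clm_comp hA).neg.add (contMDiffAt_smulRight ha₁ hz₁)).add
      (contMDiffAt_smulRight ha₂ hz₂)).congr_of_eventuallyEq ?_
    filter_upwards [hD] with x hx
    ext v
    simp [hx.Q_apply]
  have hP : ContMDiffAt 𝓘(ℝ, E) 𝓘(ℝ, F →L[ℝ] F) ∞ (fun x ↦ (D x).P) x₀ :=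
    contMDiffAt_of_isPosSqrt hg₁.continuousAt hQ (hD.mono fun x hx ↦ hx.sqrt)
  refine ⟨hz₁, hz₂, ?_, ?_⟩
  · refine contMDiffAt_of_comp_eq rfl hP ((injective_iff_map_eq_zero _).2 fun v hv ↦ h₀.P_inj hv)
      hA ?_
    filter_upwards [hD] with x hx
    ext v
    exact hx.P_φ v
  · refine (hg₁.clm_comp hP).congr_of_eventuallyEq ?_
    filter_upwards [hD] with x hx
    ext v w
    exact hx.g_apply v w

end SmoothData

/-- Compactness of the unit sphere gives `b v v ≥ c ‖v‖²` with `c > 0`. This supplies the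
boundedness field of a Riemannian metric. -/
lemma isVonNBounded_of_pos {F : Type*} [NormedAddCommGroup F] [NormedSpace ℝ F]
    [FiniteDimensional ℝ F] {b : F →L[ℝ] F →L[ℝ] ℝ} (hb : ∀ v ≠ 0, 0 < b v v) :
    Bornology.IsVonNBounded ℝ {v : F | b v v < 1} := by
  have hc : Continuous fun v : F ↦ b v v := by fun_prop
  obtain ⟨c, hc0, hcs⟩ := (isCompact_sphere (0 : F) 1).exists_forall_le' hc.continuousOn
    (a := 0) fun v hv ↦ hb v (by rintro rfl; simp at hv)
  rw [NormedSpace.isVonNBounded_iff]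
  refine isBounded_iff_forall_norm_le.2 ⟨max 1 c⁻¹, fun v (hv : b v v < 1) ↦ ?_⟩
  by_contra! h
  have h1 : 1 < ‖v‖ := (le_max_left _ _).trans_lt h
  have h2 : c⁻¹ < ‖v‖ := (le_max_right _ _).trans_lt h
  have h3 := hcs (‖v‖⁻¹ • v) (by simp [norm_smul, (norm_pos_iff.1 (by linarith : 0 < ‖v‖))])
  simp only [map_smul, smul_apply, smul_eq_mul] at h3
  have h4 : c * (‖v‖ * ‖v‖) ≤ b v v := by
    have : 0 < ‖v‖ := by linarith
    field_simp at h3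
    nlinarith
  have h5 : 1 < c * ‖v‖ := by
    rwa [inv_lt_iff_one_lt_mul₀' hc0] at h2
  nlinarith

/-! ### An auxiliary scalar product, and adapted tensors on the manifold. -/

section Geometry

variable {E : Type*} [NormedAddCommGroup E] [NormedSpace ℝ E]
  {M : Type*} [TopologicalSpace M] [ChartedSpace E M] [IsManifold 𝓘(ℝ, E) ∞ M]

lemma contMDiffAt_coord_comp_coordSymm {x₀ x₁ : M} (hx₁ : x₁ ∈ (chartAt E x₀).source) :
    ContMDiffAt 𝓘(ℝ, E) 𝓘(ℝ, E →L[ℝ] E) ∞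
      (fun x ↦ (coord (E := E) x₀ x).comp (coordSymm x₁ x)) x₁ := by
  have h := (contMDiffOn_coordChangeL (IB := 𝓘(ℝ, E)) (n := ∞)
    (trivializationAt E (TangentSpace 𝓘(ℝ, E) (M := M)) x₁)
    (trivializationAt E (TangentSpace 𝓘(ℝ, E) (M := M)) x₀)).contMDiffAt (x := x₁)
    (Filter.inter_mem (eventually_mem_source (E := E) x₁)
      ((chartAt E x₀).open_source.mem_nhds hx₁))
  refine h.congr_of_eventuallyEq ?_
  filter_upwards [eventually_mem_source (E := E) x₁, (chartAt E x₀).open_source.mem_nhds hx₁]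
    with x h1 h0
  ext v
  rw [ContinuousLinearEquiv.coe_coe, Trivialization.coordChangeL_apply _ _ ⟨h1, h0⟩,
    ContinuousLinearMap.comp_apply, coord, coordSymm, Trivialization.symmL_apply _ h1,
    Trivialization.continuousLinearMapAt_apply, Trivialization.linearMapAt_apply,
    if_pos (show x ∈ (trivializationAt E (TangentSpace 𝓘(ℝ, E)) x₀).baseSet from h0)]

variable (E M) in
/-- Smooth fields of bilinear forms on `M`. -/
abbrev BilinField : Type _ :=
  Cₛ^∞⟮𝓘(ℝ, E); E →L[ℝ] E →L[ℝ] ℝ,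
    fun x : M ↦ TangentSpace 𝓘(ℝ, E) x →L[ℝ] TangentSpace 𝓘(ℝ, E) x →L[ℝ] ℝ⟯

variable [FiniteDimensional ℝ E]

instance (x : M) : FiniteDimensional ℝ (TangentSpace 𝓘(ℝ, E) x) :=
  inferInstanceAs (FiniteDimensional ℝ E)

instance (x : M) : T2Space (TangentSpace 𝓘(ℝ, E) x) :=
  inferInstanceAs (T2Space E)

omit [FiniteDimensional ℝ E] in
lemma contMDiffAt_pullBilin_coord (b : E →L[ℝ] E →L[ℝ] ℝ) {x₀ x₁ : M}
    (hx₁ : x₁ ∈ (chartAt E x₀).source) :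
    ContMDiffAt 𝓘(ℝ, E) (𝓘(ℝ, E).prod 𝓘(ℝ, E →L[ℝ] E →L[ℝ] ℝ)) ∞
      (fun x ↦ TotalSpace.mk' (E →L[ℝ] E →L[ℝ] ℝ)
        (E := fun x : M ↦ TangentSpace 𝓘(ℝ, E) x →L[ℝ] TangentSpace 𝓘(ℝ, E) x →L[ℝ] ℝ)
          x (pullBilin (coord x₀ x) b)) x₁ := by
  rw [contMDiffAt_bilin_iff]
  have h := contMDiffAt_pullBilin (contMDiffAt_coord_comp_coordSymm hx₁)
    (contMDiffAt_const (c := b))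
  refine h.congr_of_eventuallyEq (Filter.Eventually.of_forall fun x ↦ ?_)
  ext v w
  rfl

variable (E) in
lemma exists_symm_pos : ∃ b : E →L[ℝ] E →L[ℝ] ℝ, (∀ v w, b v w = b w v) ∧ ∀ v ≠ 0, 0 < b v v :=
  ⟨pullBilin (toEuclidean : E ≃L[ℝ] _).toContinuousLinearMap (innerSL ℝ),
    fun v w ↦ real_inner_comm (toEuclidean w) (toEuclidean v),
    fun _ hv ↦ real_inner_self_pos.2 ((toEuclidean : E ≃L[ℝ] _).map_ne_zero_iff.2 hv)⟩

lemma convex_symm_pos (V : Type*) [AddCommGroup V] [Module ℝ V] [TopologicalSpace V] :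
    Convex ℝ {b : V →L[ℝ] V →L[ℝ] ℝ | (∀ v w, b v w = b w v) ∧ ∀ v ≠ 0, 0 < b v v} := by
  rintro b ⟨hb, hb'⟩ c ⟨hc, hc'⟩ s t hs ht hst
  refine ⟨fun v w ↦ ?_, fun v hv ↦ ?_⟩
  · change s * b v w + t * c v w = s * b w v + t * c w v
    rw [hb, hc]
  · change 0 < s * b v v + t * c v v
    have h1 := hb' v hv
    have h2 := hc' v hv
    rcases hs.eq_or_lt with rfl | hs
    · obtain rfl : t = 1 := by linarith
      linarith
    · positivity

-- Positive definite symmetric forms are a convex set, so constant local choices in charts are glued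
-- by a partition of unity.
set_option synthInstance.maxHeartbeats 400000 in
variable (E M) in
lemma exists_scalarProduct [T2Space M] [SecondCountableTopology M] :
    ∃ g₀ : BilinField E M, ∀ x, (∀ v w, g₀ x v w = g₀ x w v) ∧ ∀ v ≠ 0, 0 < g₀ x v v := by
  have : LocallyCompactSpace M := Manifold.locallyCompact_of_finiteDimensional 𝓘(ℝ, E)
  have : SigmaCompactSpace M := sigmaCompactSpace_of_locallyCompact_secondCountable
  obtain ⟨ip, hsymm, hpos⟩ := exists_symm_pos E
  refine exists_contMDiffSection_forall_mem_convex_of_local 𝓘(ℝ, E)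
    (fun x : M ↦ TangentSpace 𝓘(ℝ, E) x →L[ℝ] TangentSpace 𝓘(ℝ, E) x →L[ℝ] ℝ)
    (fun x ↦ {b | (∀ v w, b v w = b w v) ∧ ∀ v ≠ 0, 0 < b v v}) (fun x ↦ convex_symm_pos _)
    fun x₀ ↦ ⟨(chartAt E x₀).source, eventually_mem_source (E := E) x₀,
      fun x ↦ pullBilin (coord x₀ x) ip,
      fun x₁ hx₁ ↦ (contMDiffAt_pullBilin_coord ip hx₁).contMDiffWithinAt,
      fun x hx ↦ ⟨fun v w ↦ hsymm _ _,
        fun v hv ↦ hpos (coord x₀ x v) fun (h0 : coord x₀ x v = 0) ↦ hv ?_⟩⟩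
  rw [← coordSymm_coord hx v, h0, map_zero]

lemma IsContactPair.isSplit {h k : ℕ} {α₁ α₂ : OneForm E M} (hα : IsContactPair h k α₁ α₂)
    (x : M) : IsSplit (α₁ x).toLinearMap (α₂ x).toLinearMap (toBilin (extDerBilin α₁ x))
      (toBilin (extDerBilin α₂ x)) :=
  isSplit_of_wedge_ne_zero (fun v w ↦ (extDerBilin_apply α₁ x v w).symm)
    (fun v w ↦ (extDerBilin_apply α₂ x v w).symm) hα.top_degree (hα.volume x) (hα.pow_fst x)
    (hα.pow_snd x)

/-- Adapted data built pointwise from smooth tensor fields are smooth. -/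
lemma contMDiff_of_isAdapted {α₁ α₂ : OneForm E M} {g₀ : BilinField E M}
    {D : ∀ x : M, AdaptedData (TangentSpace 𝓘(ℝ, E) x)} (hD : ∀ x, (D x).IsAdapted)
    (ha₁ : ∀ x, (D x).a₁ = α₁ x) (ha₂ : ∀ x, (D x).a₂ = α₂ x)
    (hb₁ : ∀ x, (D x).b₁ = extDerBilin α₁ x) (hb₂ : ∀ x, (D x).b₂ = extDerBilin α₂ x)
    (hg₀ : ∀ x, (D x).g₀ = g₀ x) (x₀ : M) :
    ContMDiffAt 𝓘(ℝ, E) 𝓘(ℝ, E) ∞ (fun x ↦ coord x₀ x (D x).z₁) x₀ ∧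
    ContMDiffAt 𝓘(ℝ, E) 𝓘(ℝ, E) ∞ (fun x ↦ coord x₀ x (D x).z₂) x₀ ∧
    ContMDiffAt 𝓘(ℝ, E) 𝓘(ℝ, E →L[ℝ] E) ∞
      (fun x ↦ ((coord x₀ x).comp (D x).φ).comp (coordSymm x₀ x)) x₀ ∧
    ContMDiffAt 𝓘(ℝ, E) 𝓘(ℝ, E →L[ℝ] E →L[ℝ] ℝ) ∞ (fun x ↦ coordBilin x₀ x (D x).g) x₀ := by
  refine contMDiffAt_of_isAdapted (D := fun x ↦ (D x).conj (coord x₀ x) (coordSymm x₀ x))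
    ?_ ?_ ?_ ?_ ?_ ?_
  · filter_upwards [eventually_mem_source (E := E) x₀] with x hx
    exact (hD x).conj (coord_coordSymm hx) (coordSymm_coord hx)
  · simp only [AdaptedData.conj, ha₁]
    exact (contMDiffAt_oneForm_iff _ (mem_chart_source E x₀)).1 (α₁.contMDiff x₀)
  · simp only [AdaptedData.conj, ha₂]
    exact (contMDiffAt_oneForm_iff _ (mem_chart_source E x₀)).1 (α₂.contMDiff x₀)
  · simp only [AdaptedData.conj, hb₁]
    exact (contMDiffAt_bilin_iff _ x₀).1 (contMDiff_extDerBilin α₁ x₀)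
  · simp only [AdaptedData.conj, hb₂]
    exact (contMDiffAt_bilin_iff _ x₀).1 (contMDiff_extDerBilin α₂ x₀)
  · simp only [AdaptedData.conj, hg₀]
    exact (contMDiffAt_bilin_iff _ x₀).1 (g₀.contMDiff x₀)

end Geometry

end ContactPair

end

/-! ### Assembly of the metric contact pair. -/

theorem mainTheorem4 {E : Type*} [NormedAddCommGroup E] [NormedSpace ℝ E] [FiniteDimensional ℝ E]
    {M : Type*} [TopologicalSpace M] [T2Space M] [SecondCountableTopology M]
    [ChartedSpace E M] [IsManifold 𝓘(ℝ, E) ∞ M]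
    (h k : ℕ) (α₁ α₂ : ContactPair.OneForm E M) (hα : ContactPair.IsContactPair h k α₁ α₂) :
    ∃ (φ : ContactPair.EndField E M) (g : ContactPair.Metric E M),
      ContactPair.IsMetricContactPair h k α₁ α₂ φ g ∧ ContactPair.IsDecomposable α₁ α₂ φ := by
  obtain ⟨g₀, hg₀⟩ := ContactPair.exists_scalarProduct E M
  -- Pointwise choice does no harm: the defining equations determine the tensors, so they are
  -- smooth.
  choose D hD ha₁ ha₂ hb₁ hb₂ hDg₀ using fun x ↦
    ContactPair.exists_isAdapted (hα.isSplit x) (hg₀ x).1 (hg₀ x).2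
  have hs (x : M) : ContactPair.IsSplit (D x).a₁.toLinearMap (D x).a₂.toLinearMap
      (ContactPair.toBilin (D x).b₁) (ContactPair.toBilin (D x).b₂) := by
    rw [ha₁, ha₂, hb₁, hb₂]; exact hα.isSplit x
  have hsymm (x : M) (v w : TangentSpace 𝓘(ℝ, E) x) : (D x).g₀ v w = (D x).g₀ w v := by
    rw [hDg₀]; exact (hg₀ x).1 v w
  have hsm := ContactPair.contMDiff_of_isAdapted hD ha₁ ha₂ hb₁ hb₂ hDg₀
  have hd₁ (x : M) (v w : TangentSpace 𝓘(ℝ, E) x) :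
      ContactPair.extDer α₁ x ![v, w] = (D x).b₁ v w := by
    rw [hb₁, ContactPair.extDerBilin_apply]
  have hd₂ (x : M) (v w : TangentSpace 𝓘(ℝ, E) x) :
      ContactPair.extDer α₂ x ![v, w] = (D x).b₂ v w := by
    rw [hb₂, ContactPair.extDerBilin_apply]
  let Z₁ : ContactPair.VectorField E M :=
    ⟨fun x ↦ (D x).z₁, fun x₀ ↦ (ContactPair.contMDiffAt_vector_iff _ x₀).2 (hsm x₀).1⟩
  let Z₂ : ContactPair.VectorField E M :=
    ⟨fun x ↦ (D x).z₂, fun x₀ ↦ (ContactPair.contMDiffAt_vector_iff _ x₀).2 (hsm x₀).2.1⟩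
  let φ : ContactPair.EndField E M :=
    ⟨fun x ↦ (D x).φ, fun x₀ ↦ (ContactPair.contMDiffAt_end_iff _ x₀).2 (hsm x₀).2.2.1⟩
  let g : ContactPair.Metric E M :=
    { inner := fun x ↦ (D x).g
      symm := fun x v w ↦ (hD x).g_symm (hsymm x) v w
      pos := fun x v hv ↦ (hD x).g_pos hv
      isVonNBounded := fun x ↦ ContactPair.isVonNBounded_of_pos (F := E) fun v hv ↦ (hD x).g_pos hv
      contMDiff := fun x₀ ↦ (ContactPair.contMDiffAt_bilin_iff _ x₀).2 (hsm x₀).2.2.2 }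
  have hZ₁ (x : M) := (hD x).z₁_spec (hs x)
  have hZ₂ (x : M) := (hD x).z₂_spec (hs x)
  refine ⟨φ, g, ⟨Z₁, Z₂, ?_, ?_⟩, ?_⟩
  · refine ⟨hα, ?_, fun x v ↦ ?_, fun x ↦ (hD x).φ_z₁ (hs x), fun x ↦ (hD x).φ_z₂ (hs x)⟩
    · exact
        { one_one := fun x ↦ by rw [← ha₁]; exact (hZ₁ x).1
          two_two := fun x ↦ by rw [← ha₂]; exact (hZ₂ x).1
          one_two := fun x ↦ by rw [← ha₁]; exact (hZ₂ x).2.1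
          two_one := fun x ↦ by rw [← ha₂]; exact (hZ₁ x).2.1
          contr_one_one := fun x w ↦ by rw [hd₁]; exact (hZ₁ x).2.2.1 w
          contr_one_two := fun x w ↦ by rw [hd₂]; exact (hZ₁ x).2.2.2 w
          contr_two_one := fun x w ↦ by rw [hd₁]; exact (hZ₂ x).2.2.2 w
          contr_two_two := fun x w ↦ by rw [hd₂]; exact (hZ₂ x).2.2.1 w }
    · rw [← ha₁, ← ha₂]
      exact (hD x).φ_φ (hs x) (hsymm x) v
  · exact
      { inner_map := fun x v w ↦ by
          rw [hd₁, hd₂]; exact (hD x).g_φ (hs x) (hsymm x) v w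
        inner_one := fun x v ↦ by rw [← ha₁]; exact (hD x).g_z₁ (hs x) (hsymm x) v
        inner_two := fun x v ↦ by rw [← ha₂]; exact (hD x).g_z₂ (hs x) (hsymm x) v }
  · refine fun x v ↦ ⟨fun hv ↦ ⟨?_, fun w ↦ ?_⟩, fun hv ↦ ⟨?_, fun w ↦ ?_⟩⟩
    · rw [← ha₁]; exact (hD x).a₁_φ (hs x) (hsymm x) v
    · rw [hd₁]
      exact (hD x).b₁_φ (hs x) (fun w ↦ by rw [← hd₁]; exact hv.2 w) w
    -- The second foliation follows by exchanging the two forms.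
    · rw [← ha₂]; exact (hD x).swap.a₁_φ (hs x).swap (hsymm x) v
    · rw [hd₂]
      exact (hD x).swap.b₁_φ (hs x).swap
        (fun w ↦ (hd₂ x v w).symm.trans (hv.2 w)) w
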